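/- Let $\kappa,\tau,H\in\mathbb R$ with $\kappa>0$, $\tau\ne 0$, $\kappa\neq 4\tau^2$ and $H>0$. Let $\mathbb S^3_b(\kappa,\tau)$ be the Berger sphere, that is, $\mathbb S^3=\{(z,w)\in\mathbb C^2: |z|^2+|w|^2=1\}$ with the Riemannian metric $$g(X,Y)=\frac4\kappa\Big[\langle X,Y\rangle+\Big(\frac{4\tau^2}{\kappa}-1\Big)\langle X,V\rangle\langle Y,V\rangle\Big],\qquad V_{(z,w)}=(iz,iw),$$ where $\langle\,,\rangle$ is the standard metric. Put $a=\arctan\big(\sqrt\kappa/(2H)\big)$ and, for $0\le x\le a$, $$\lambda(x)=\frac{\sqrt{1-\frac{4H^2}{\kappa}\tan^2x}}{\sqrt{1+\frac{4\tau^2}{\kappa}\tan^2x}},$$ $$y(x)=\begin{cases}-\arctan\big(\frac\tau H\lambda(x)\big)+\frac H\tau\frac{\sqrt{4\tau^2-\kappa}}{\sqrt{4H^2+\kappa}}\arctan\Big(\frac{\sqrt{4\tau^2-\kappa}}{\sqrt{4H^2+\kappa}}\lambda(x)\Big)&\text{if }\kappa-4\tau^2<0,\\[2mm]-\arctan\big(\frac\tau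 H\lambda(x)\big)-\frac H\tau\frac{\sqrt{\kappa-4\tau^2}}{\sqrt{4H^2+\kappa}}\operatorname{arctanh}\Big(\frac{\sqrt{\kappa-4\tau^2}}{\sqrt{4H^2+\kappa}}\lambda(x)\Big)&\text{if }\kappa-4\tau^2>0.\end{cases}$$ Let $\Phi:\,]-a,a[\,\times\,]-\pi,\pi[\ \to\mathbb S^3_b(\kappa,\tau)$ be $$\Phi(x,t)=\begin{cases}\big(\cos(x+a)e^{iy(x+a)},\ \sin(x+a)e^{it}\big)&\text{if }x<0,\\ \big(\cos(a-x)e^{-iy(a-x)},\ \sin(a-x)e^{it}\big)&\text{if }x\ge0.\end{cases}$$ Then $\Phi$ defines an immersion of a sphere with constant mean curvature $H$: there are a continuous strictly increasing $\theta:[-a,a]\to[0,\pi]$ with $\theta(-a)=0$ and $\theta(a)=\pi$, smooth with positive derivative on $]-a,a[\,\setminus\{0\}$, and a smooth immersion $F:\mathbb S^2\to\mathbb S^3_b(\kappa,\tau)$ such that $$F\big(\sin\theta(x)\cos t,\ \sin\theta(x)\sin t,\ \cos\theta(x)\big)=\Phi(x,t)\qquad\text{for all }x\in\,]-a,a[,\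 t\in\,]-\pi,\pi[,$$ and $F$ has constant mean curvature $H$ (half of the trace of the second fundamental form) with respect to a suitable unit normal field. Moreover, for all $\theta$ and all smooth immersions $F$ of $\mathbb S^2$ related to $\Phi$ in this way: if $\tau>0$, then $F$ is an embedding if and only if $y(0)>-\pi$; if $\tau<0$, then $F$ is an embedding if and only if $y(0)<\pi$. -/

import Mathlib

open scoped Manifold ContDiff

noncomputable section

namespace BergerSphere

/-! ### The spheres -/

/-- `ℂ²`, as a real Euclidean space of dimension `4`. -/
abbrev C2 : Type := EuclideanSpace ℂ (Fin 2)

/-- `𝕊³ = {(z, w) ∈ ℂ² : |z|² + |w|² = 1}`. -/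
abbrev S3 : Type := Metric.sphere (0 : C2) 1

/-- `𝕊² ⊂ ℝ³`. -/
abbrev S2 : Type := Metric.sphere (0 : EuclideanSpace ℝ (Fin 3)) 1

instance finrank_C2 : Fact (Module.finrank ℝ C2 = 3 + 1) := ⟨by
  have h : Module.finrank ℂ C2 = 2 := by simp
  have h2 := Module.finrank_mul_finrank ℝ ℂ C2
  rw [h, Complex.finrank_real_complex] at h2
  omega⟩

/-! ### The Berger metric and the mean curvature -/

/-- The field `V_(z,w) = (iz, iw)`. -/
def V (p : C2) : C2 := Complex.I • p

/-- The Berger metric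
`g(X, Y) = (4/κ) (⟨X, Y⟩ + (4τ²/κ - 1) ⟨X, V⟩ ⟨Y, V⟩)`, at `p` on the vectors `X`, `Y`.
It is written for all `p`, `X`, `Y` in `ℂ²`, and the Berger sphere `𝕊³_b(κ, τ)` is `𝕊³` with the
restriction of this form to its tangent spaces. On a neighbourhood of `𝕊³` in `ℂ²`
the form is positive definite, so that `𝕊³_b(κ, τ)` is a Riemannian hypersurface there. -/
def metric (κ τ : ℝ) (p X Y : C2) : ℝ :=
  4 / κ * (inner ℝ X Y + (4 * τ ^ 2 / κ - 1) * inner ℝ X (V p) * inner ℝ Y (V p))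

/-- The Christoffel symbol of the first kind at `p`, which is `g(∇_X Y, Z)` for constant vector
fields `X, Y, Z` of `ℂ²`:
`(1/2) (X (g(Y, Z)) + Y (g(X, Z)) - Z (g(X, Y)))`. -/
def christoffel (κ τ : ℝ) (p X Y Z : C2) : ℝ :=
  1 / 2 * (fderiv ℝ (fun q => metric κ τ q Y Z) p X
    + fderiv ℝ (fun q => metric κ τ q X Z) p Y
    - fderiv ℝ (fun q => metric κ τ q X Y) p Z)

/-- The partial derivative `∂_i f`. -/
def pd (i : Fin 2) (f : EuclideanSpace ℝ (Fin 2) → C2) (u : EuclideanSpace ℝ (Fin 2)) : C2 :=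
  fderiv ℝ f u (EuclideanSpace.single i 1)

/-- The first fundamental form `g(∂_i f, ∂_j f)` of a parametrized surface `f` of `𝕊³_b(κ, τ)`. -/
def firstForm (κ τ : ℝ) (f : EuclideanSpace ℝ (Fin 2) → C2) (u : EuclideanSpace ℝ (Fin 2)) :
    Matrix (Fin 2) (Fin 2) ℝ :=
  Matrix.of fun i j => metric κ τ (f u) (pd i f u) (pd j f u)

/-- The second fundamental form `g(∇_{∂_i} ∂_j f, n)` of a parametrized surface `f` of
`𝕊³_b(κ, τ)` with unit normal `n` at the parameter `u`. As `n` is tangent to `𝕊³`, and the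
Levi-Civita connection of `𝕊³_b(κ, τ)` is the tangential part of the one of the metric on a
neighbourhood of `𝕊³`, the latter may be used for `∇`. -/
def secondForm (κ τ : ℝ) (f : EuclideanSpace ℝ (Fin 2) → C2) (n : C2)
    (u : EuclideanSpace ℝ (Fin 2)) : Matrix (Fin 2) (Fin 2) ℝ :=
  Matrix.of fun i j => metric κ τ (f u) (pd i (pd j f) u) n
    + christoffel κ τ (f u) (pd i f u) (pd j f u) n

/-- The mean curvature: half of the trace of the second fundamental form with respect to the
first. -/
def meanCurvature (κ τ : ℝ) (f : EuclideanSpace ℝ (Fin 2) → C2) (n : C2)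
    (u : EuclideanSpace ℝ (Fin 2)) : ℝ :=
  1 / 2 * ((firstForm κ τ f u)⁻¹ * secondForm κ τ f n u).trace

section Surfaces

variable {M : Type*} [TopologicalSpace M] [ChartedSpace (EuclideanSpace ℝ (Fin 2)) M]

/-- Smooth immersions of a surface into `𝕊³`. -/
def IsImmersion (F : M → S3) : Prop :=
  ContMDiff (𝓡 2) (𝓡 3) ∞ F ∧ ∀ p, Function.Injective (mfderiv (𝓡 2) (𝓡 3) F p)

/-- Smooth embeddings of a surface into `𝕊³`: immersions that are homeomorphisms onto their
image. -/
def IsEmbedding (F : M → S3) : Prop :=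
  IsImmersion F ∧ Topology.IsEmbedding F

/-- `N` is a (continuous) unit normal field along `F : M → 𝕊³_b(κ, τ)`. -/
structure IsUnitNormal (κ τ : ℝ) (F : M → S3) (N : M → C2) : Prop where
  continuous : Continuous N
  tangent : ∀ p, inner ℝ (F p : C2) (N p) = 0
  unit : ∀ p, metric κ τ (F p) (N p) (N p) = 1
  normal : ∀ p, ∀ v : TangentSpace (𝓡 2) p,
    metric κ τ (F p) (mfderiv (𝓡 2) 𝓘(ℝ, C2) (fun q => (F q : C2)) p v) (N p) = 0

/-- `F : M → 𝕊³_b(κ, τ)` has constant mean curvature `H` with respect to some unit normal field,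
computed in all charts of the surface `M`. -/
def HasConstantMeanCurvature (κ τ : ℝ) (F : M → S3) (H : ℝ) : Prop :=
  ∃ N : M → C2, IsUnitNormal κ τ F N ∧
    ∀ e ∈ IsManifold.maximalAtlas (𝓡 2) ∞ M, ∀ u ∈ e.target,
      meanCurvature κ τ (fun v => (F (e.symm v) : C2)) (N (e.symm u)) u = H

end Surfaces

/-! ### The explicit map -/

/-- `λ(x) = √(1 - (4H²/κ) tan² x) / √(1 + (4τ²/κ) tan² x)`. -/
def lam (κ τ H x : ℝ) : ℝ :=
  √(1 - 4 * H ^ 2 / κ * Real.tan x ^ 2) / √(1 + 4 * τ ^ 2 / κ * Real.tan x ^ 2)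

/-- The function `y`. -/
def y (κ τ H x : ℝ) : ℝ :=
  if κ - 4 * τ ^ 2 < 0 then
    -Real.arctan (τ / H * lam κ τ H x)
      + H / τ * (√(4 * τ ^ 2 - κ) / √(4 * H ^ 2 + κ))
        * Real.arctan (√(4 * τ ^ 2 - κ) / √(4 * H ^ 2 + κ) * lam κ τ H x)
  else
    -Real.arctan (τ / H * lam κ τ H x)
      - H / τ * (√(κ - 4 * τ ^ 2) / √(4 * H ^ 2 + κ))
        * Real.artanh (√(κ - 4 * τ ^ 2) / √(4 * H ^ 2 + κ) * lam κ τ H x)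

/-- `a = arctan(√κ / (2H))`. -/
def a (κ H : ℝ) : ℝ := Real.arctan (√κ / (2 * H))

/-- The map `Φ(x, t)`. -/
def Φ (κ τ H x t : ℝ) : C2 :=
  if x < 0 then
    !₂[Real.cos (x + a κ H) * Complex.exp (Complex.I * y κ τ H (x + a κ H)),
      Real.sin (x + a κ H) * Complex.exp (Complex.I * t)]
  else
    !₂[Real.cos (a κ H - x) * Complex.exp (-(Complex.I * y κ τ H (a κ H - x))),
      Real.sin (a κ H - x) * Complex.exp (Complex.I * t)]

/-- Spherical coordinates on `𝕊²`, with polar angle `θ` and longitude `t`. -/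
def spherical (θ t : ℝ) : S2 :=
  ⟨!₂[Real.sin θ * Real.cos t, Real.sin θ * Real.sin t, Real.cos θ], by
    rw [mem_sphere_zero_iff_norm, EuclideanSpace.norm_eq, Real.sqrt_eq_one]
    simp only [Fin.sum_univ_three, Real.norm_eq_abs, sq_abs]
    simp only [Matrix.cons_val_zero, Matrix.cons_val_one, Matrix.cons_val]
    nlinarith [Real.sin_sq_add_cos_sq θ, Real.sin_sq_add_cos_sq t]⟩

/-- The map `F : 𝕊² → 𝕊³` is the map of the sphere that `Φ` defines: `x ∈ ]-a, a[` and
`t ∈ ]-π, π[` are coordinates on the sphere minus a closed meridian, where `t` is the longitude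
and the polar angle `θ(x)` increases continuously from `0` at `x = -a` to `π` at `x = a`, smoothly
and with positive derivative away from the circle `x = 0` on which the two pieces of `Φ` meet, and
in these coordinates `F` is `Φ`. -/
structure IsSphereOf (κ τ H : ℝ) (θ : ℝ → ℝ) (F : S2 → S3) : Prop where
  continuousOn : ContinuousOn θ (Set.Icc (-a κ H) (a κ H))
  strictMonoOn : StrictMonoOn θ (Set.Icc (-a κ H) (a κ H))
  left : θ (-a κ H) = 0
  right : θ (a κ H) = Real.pi
  smooth : ContDiffOn ℝ ∞ θ (Set.Ioo (-a κ H) (a κ H) \ {0})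
  deriv_pos : ∀ x ∈ Set.Ioo (-a κ H) (a κ H) \ {0}, 0 < deriv θ x
  eq : ∀ x ∈ Set.Ioo (-a κ H) (a κ H), ∀ t ∈ Set.Ioo (-Real.pi) Real.pi,
    (F (spherical (θ x) t) : C2) = Φ κ τ H x t

end BergerSphere

end

noncomputable section

namespace BergerSphere

/-! ### Analysis of the profile curve -/

/-! The angle `y` is a function of `λ` alone, it is odd in `λ`, and the two halves of `Φ` correspond
to `z = λ` and `z = -λ`. So `z` runs through `[-1, 1]` and can serve as the height on `𝕊²`. In terms
of `z` the square roots that spoil smoothness disappear: `exp(-i arctan(τz/H))` is `H - iτz` divided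
by its modulus, that modulus cancels against the one in `cos`, and `sin` contains the factor `√(1 -
z²)`, which is the radius of the circle of latitude. Hence `Φ` is the restriction to `𝕊²` of
`ambientMap`, which is smooth near every point of the sphere, including the poles and the equator `x
= 0`.

Mean curvature: by `hasDerivAt_pole` the derivative of the first coordinate is a real multiple of `i
exp(i phase)`, so all tangent vectors are orthogonal to `frame`. The unit normal is a combination of
`frame`, the position and `V`. Differentiating the orthogonality relations gives the second
fundamental form without second derivatives of the map. It equals `H I + T`. At the poles `T = 0`.
Elsewhere there are two one-forms `η`, `ξ` for which `I` and `T` are, up to scalar factors, `(H² +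
τ²) η² + 2H ηξ + ξ²` and `H η² + 2 ηξ + H/(H² + τ²) ξ²`. Their mixed discriminant is proportional to
`H + H - 2H = 0`, so the trace is `2H` (`meanCurvature_ambientMap`).

Embeddedness: two points with the same image have parameters `x' = ±x`, since the modulus of the
second coordinate determines `|x|`. For `x' = -x` the first coordinates agree iff `sin(angle) = 0`.
As `τ * angle` is strictly decreasing on `[0, 1]` from `0`, this happens away from the equator iff
`|y(0)| ≥ π`, by the intermediate value theorem. Since `τ y(0) < 0`, only one of the two bounds in
`|y(0)| < π` matters. -/

theorem hasDerivAt_artanh {x : ℝ} (hx : x ^ 2 < 1) :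
    HasDerivAt Real.artanh (1 / (1 - x ^ 2)) x := by
  have h1 : -1 < x := by nlinarith
  have h2 : x < 1 := by nlinarith
  have hp : 0 < (1 + x) / (1 - x) := div_pos (by linarith) (by linarith)
  have hd : HasDerivAt (fun t : ℝ => (1 + t) / (1 - t)) (2 / (1 - x) ^ 2) x := by
    have := ((hasDerivAt_id x).const_add 1).div ((hasDerivAt_id x).const_sub 1)
      (by simp only [id]; linarith)
    refine this.congr_deriv ?_
    simp only [id]
    ring
  have := (hd.sqrt hp.ne').log (Real.sqrt_pos.2 hp).ne'
  refine this.congr_deriv ?_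
  rw [div_div]
  have hs : 2 * √((1 + x) / (1 - x)) * √((1 + x) / (1 - x)) = 2 * ((1 + x) / (1 - x)) := by
    rw [mul_assoc, Real.mul_self_sqrt hp.le]
  rw [hs]
  have e1 : (1 - x) ≠ 0 := by linarith
  have e2 : (1 + x) ≠ 0 := by linarith
  have e3 : 1 - x ^ 2 ≠ 0 := by linarith
  field_simp
  ring

theorem contDiffAt_artanh {x : ℝ} (hx : x ^ 2 < 1) : ContDiffAt ℝ ∞ Real.artanh x := by
  have h1 : -1 < x := by nlinarith
  have h2 : x < 1 := by nlinarith
  have hp : 0 < (1 + x) / (1 - x) := div_pos (by linarith) (by linarith)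
  have : ContDiffAt ℝ ∞ (fun t : ℝ => (1 + t) / (1 - t)) x :=
    (contDiffAt_const.add contDiffAt_id).div (contDiffAt_const.sub contDiffAt_id)
      (by simpa only [id] using (by linarith : (1:ℝ) - x ≠ 0))
  exact (this.sqrt hp.ne').log (Real.sqrt_pos.2 hp).ne'

theorem artanh_neg_eq {x : ℝ} (hx : x ^ 2 < 1) : Real.artanh (-x) = -Real.artanh x := by
  have h1 : -1 < x := by nlinarith
  have h2 : x < 1 := by nlinarith
  rw [Real.artanh, Real.artanh, ← Real.log_inv, ← Real.sqrt_inv, inv_div, sub_neg_eq_add,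
    ← sub_eq_add_neg]

/-- The quantity `4H² + κ + (4τ² - κ) z²`, which is `4H² + 4τ² z² + κ(1 - z²)`. -/
def denom (κ τ H z : ℝ) : ℝ := 4 * H ^ 2 + κ + (4 * τ ^ 2 - κ) * z ^ 2

theorem denom_pos {κ H : ℝ} (τ : ℝ) {z : ℝ} (hκ : 0 < κ) (hH : 0 < H) (hz : z ^ 2 ≤ 1) :
    0 < denom κ τ H z := by
  have h : denom κ τ H z = 4 * H ^ 2 + 4 * (τ * z) ^ 2 + κ * (1 - z ^ 2) := by
    unfold denom; ring
  rw [h]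
  have := mul_nonneg hκ.le (sub_nonneg.2 hz)
  positivity

/-- The square root of the reciprocal of `denom`. -/
def scale (κ τ H z : ℝ) : ℝ := (√(denom κ τ H z))⁻¹

/-- The part of the angle function that is added to `-arctan (τ z / H)`. -/
def phase (κ τ H z : ℝ) : ℝ :=
  if κ - 4 * τ ^ 2 < 0 then
    H / τ * (√(4 * τ ^ 2 - κ) / √(4 * H ^ 2 + κ))
        * Real.arctan (√(4 * τ ^ 2 - κ) / √(4 * H ^ 2 + κ) * z)
  else
    - (H / τ * (√(κ - 4 * τ ^ 2) / √(4 * H ^ 2 + κ))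
        * Real.artanh (√(κ - 4 * τ ^ 2) / √(4 * H ^ 2 + κ) * z))

/-- The function of `λ` that the angle `y` is. -/
def angle (κ τ H z : ℝ) : ℝ := -Real.arctan (τ / H * z) + phase κ τ H z

theorem y_eq_angle (κ τ H x : ℝ) : y κ τ H x = angle κ τ H (lam κ τ H x) := by
  unfold y angle phase
  split_ifs <;> ring

section

variable {κ τ H z : ℝ}

theorem scale_pos (hκ : 0 < κ) (hH : 0 < H) (hz : z ^ 2 ≤ 1) : 0 < scale κ τ H z :=
  inv_pos.2 (Real.sqrt_pos.2 (denom_pos τ hκ hH hz))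

theorem scale_sq_mul_denom (hκ : 0 < κ) (hH : 0 < H) (hz : z ^ 2 ≤ 1) :
    scale κ τ H z ^ 2 * denom κ τ H z = 1 := by
  have h := denom_pos τ hκ hH hz
  rw [scale, inv_pow, Real.sq_sqrt h.le, inv_mul_cancel₀ h.ne']

theorem sqrt_div_sq (hκ : 0 < κ) {d : ℝ} (hd : 0 ≤ d) :
    (√d / √(4 * H ^ 2 + κ)) ^ 2 = d / (4 * H ^ 2 + κ) := by
  rw [div_pow, Real.sq_sqrt hd, Real.sq_sqrt (by positivity)]

/-- Because `κ - 4τ² < 4H² + κ`, the argument stays in the domain where `artanh` is smooth, even at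
`z = ±1`. -/
theorem sq_artanh_arg_lt_one (hκ : 0 < κ) (hτ : τ ≠ 0) (hH : 0 < H) (hz : z ^ 2 ≤ 1)
    (h : ¬ κ - 4 * τ ^ 2 < 0) : (√(κ - 4 * τ ^ 2) / √(4 * H ^ 2 + κ) * z) ^ 2 < 1 := by
  rw [mul_pow, sqrt_div_sq hκ (not_lt.1 h), div_mul_eq_mul_div, div_lt_one (by positivity)]
  have h1 : 0 < τ ^ 2 := by positivity
  nlinarith [mul_le_mul_of_nonneg_left hz (not_lt.1 h), sq_nonneg H]

/-- Both branches have the same rational derivative, so the sign of `κ - 4τ²` plays no role in the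
differential geometry below. -/
theorem hasDerivAt_phase (hκ : 0 < κ) (hτ : τ ≠ 0) (hH : 0 < H) (hz : z ^ 2 ≤ 1) :
    HasDerivAt (phase κ τ H) (H / τ * (4 * τ ^ 2 - κ) * scale κ τ H z ^ 2) z := by
  have hD := denom_pos τ hκ hH hz
  have hs : scale κ τ H z ^ 2 = 1 / denom κ τ H z := by
    rw [eq_div_iff hD.ne', scale_sq_mul_denom hκ hH hz]
  have hK : 0 < 4 * H ^ 2 + κ := by positivity
  rw [hs]
  by_cases h : κ - 4 * τ ^ 2 < 0
  · have hf : phase κ τ H = fun z => H / τ * (√(4 * τ ^ 2 - κ) / √(4 * H ^ 2 + κ))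
        * Real.arctan (√(4 * τ ^ 2 - κ) / √(4 * H ^ 2 + κ) * z) := by
      funext z; rw [phase, if_pos h]
    rw [hf]
    have hq := sqrt_div_sq (H := H) hκ (show 0 ≤ 4 * τ ^ 2 - κ by linarith)
    set q := √(4 * τ ^ 2 - κ) / √(4 * H ^ 2 + κ)
    have := (((hasDerivAt_id z).const_mul q).arctan).const_mul (H / τ * q)
    refine this.congr_deriv ?_
    simp only [id, mul_pow, hq, mul_one]
    rw [show H / τ * q * (1 / (1 + (4 * τ ^ 2 - κ) / (4 * H ^ 2 + κ) * z ^ 2) * q)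
      = H / τ * q ^ 2 * (1 / (1 + (4 * τ ^ 2 - κ) / (4 * H ^ 2 + κ) * z ^ 2)) by ring, hq]
    have e : 1 + (4 * τ ^ 2 - κ) / (4 * H ^ 2 + κ) * z ^ 2
        = denom κ τ H z / (4 * H ^ 2 + κ) := by
      unfold denom; field_simp
    rw [e]
    field_simp
  · have hf : phase κ τ H = fun z => - (H / τ * (√(κ - 4 * τ ^ 2) / √(4 * H ^ 2 + κ))
        * Real.artanh (√(κ - 4 * τ ^ 2) / √(4 * H ^ 2 + κ) * z)) := by
      funext z; rw [phase, if_neg h]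
    rw [hf]
    have hlt := sq_artanh_arg_lt_one hκ hτ hH hz h
    have hq := sqrt_div_sq (H := H) hκ (not_lt.1 h)
    set q := √(κ - 4 * τ ^ 2) / √(4 * H ^ 2 + κ)
    have := (((hasDerivAt_artanh hlt).comp z
      ((hasDerivAt_id z).const_mul q)).const_mul (H / τ * q)).neg
    refine this.congr_deriv ?_
    simp only [mul_pow, hq, mul_one]
    rw [show -(H / τ * q * (1 / (1 - (κ - 4 * τ ^ 2) / (4 * H ^ 2 + κ) * z ^ 2) * q))
      = - (H / τ * q ^ 2 * (1 / (1 - (κ - 4 * τ ^ 2) / (4 * H ^ 2 + κ) * z ^ 2))) by ring, hq]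
    have e : 1 - (κ - 4 * τ ^ 2) / (4 * H ^ 2 + κ) * z ^ 2
        = denom κ τ H z / (4 * H ^ 2 + κ) := by
      unfold denom; field_simp; ring
    rw [e]
    field_simp
    ring

theorem contDiffAt_phase (hκ : 0 < κ) (hτ : τ ≠ 0) (hH : 0 < H) (hz : z ^ 2 ≤ 1) :
    ContDiffAt ℝ ∞ (phase κ τ H) z := by
  unfold phase
  by_cases h : κ - 4 * τ ^ 2 < 0
  · simp only [if_pos h]
    exact contDiffAt_const.mul (contDiffAt_const.mul contDiffAt_id).arctan
  · simp only [if_neg h]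
    exact (contDiffAt_const.mul ((contDiffAt_artanh (sq_artanh_arg_lt_one hκ hτ hH hz h)).comp z
      (contDiffAt_const.mul contDiffAt_id))).neg

theorem angle_neg (hκ : 0 < κ) (hτ : τ ≠ 0) (hH : 0 < H) (hz : z ^ 2 ≤ 1) :
    angle κ τ H (-z) = -angle κ τ H z := by
  unfold angle phase
  split_ifs with h
  · simp only [mul_neg, Real.arctan_neg]; ring
  · simp only [mul_neg, Real.arctan_neg, artanh_neg_eq (sq_artanh_arg_lt_one hκ hτ hH hz h)]; ring

theorem angle_zero : angle κ τ H 0 = 0 := by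
  simp [angle, phase]

/-- The two contributions combine into a term whose sign is opposite to that of `τ`; this is the
source of the monotonicity used for embeddedness. -/
theorem hasDerivAt_angle (hκ : 0 < κ) (hτ : τ ≠ 0) (hH : 0 < H) (hz : z ^ 2 ≤ 1) :
    HasDerivAt (angle κ τ H) (-(κ * H * (H ^ 2 + τ ^ 2) / τ * scale κ τ H z ^ 2
      / (H ^ 2 + τ ^ 2 * z ^ 2))) z := by
  have hD := denom_pos τ hκ hH hz
  have hs : scale κ τ H z ^ 2 = 1 / denom κ τ H z := by
    rw [eq_div_iff hD.ne', scale_sq_mul_denom hκ hH hz]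
  have := (((hasDerivAt_id z).const_mul (τ / H)).arctan).neg.add (hasDerivAt_phase hκ hτ hH hz)
  refine this.congr_deriv ?_
  have h1 : 0 < H ^ 2 + τ ^ 2 * z ^ 2 := by positivity
  have e : 1 + (τ / H * z) ^ 2 = (H ^ 2 + τ ^ 2 * z ^ 2) / H ^ 2 := by field_simp
  simp only [id, hs, e]
  have hD' := hD.ne'
  field_simp
  unfold denom
  ring

theorem contDiffAt_scale (hκ : 0 < κ) (hH : 0 < H) (hz : z ^ 2 ≤ 1) :
    ContDiffAt ℝ ∞ (scale κ τ H) z := by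
  have h := denom_pos τ hκ hH hz
  have hd : ContDiffAt ℝ ∞ (denom κ τ H) z := by
    unfold denom; fun_prop
  exact (hd.sqrt h.ne').inv (Real.sqrt_pos.2 h).ne'

theorem hasDerivAt_scale (hκ : 0 < κ) (hH : 0 < H) (hz : z ^ 2 ≤ 1) :
    HasDerivAt (scale κ τ H) (-((4 * τ ^ 2 - κ) * z * scale κ τ H z ^ 3)) z := by
  have h := denom_pos τ hκ hH hz
  have hd : HasDerivAt (denom κ τ H) ((4 * τ ^ 2 - κ) * (2 * z)) z := by
    have := ((hasDerivAt_pow 2 z).const_mul (4 * τ ^ 2 - κ)).const_add (4 * H ^ 2 + κ)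
    exact this.congr_deriv (by simp)
  have := (hd.sqrt h.ne').inv (Real.sqrt_pos.2 h).ne'
  refine this.congr_deriv ?_
  have hs := (Real.sqrt_pos.2 h).ne'
  simp only [scale]
  field_simp

/-- The first complex coordinate of the sphere at height `z`. -/
def pole (κ τ H z : ℝ) : ℂ :=
  scale κ τ H z * (2 * (H - Complex.I * (τ * z))) * Complex.exp (Complex.I * phase κ τ H z)

theorem hasDerivAt_exp_phase (hκ : 0 < κ) (hτ : τ ≠ 0) (hH : 0 < H) (hz : z ^ 2 ≤ 1) :
    HasDerivAt (fun z => Complex.exp (Complex.I * phase κ τ H z))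
      (Complex.I * (H / τ * (4 * τ ^ 2 - κ) * scale κ τ H z ^ 2 : ℝ)
        * Complex.exp (Complex.I * phase κ τ H z)) z := by
  have := ((hasDerivAt_phase hκ hτ hH hz).ofReal_comp.const_mul Complex.I).cexp
  exact this.congr_deriv (by ring)

/-- In the product rule the real multiples of `exp(i phase)` cancel and only an imaginary multiple
survives. This makes `frame` orthogonal to the surface. -/
theorem hasDerivAt_pole (hκ : 0 < κ) (hτ : τ ≠ 0) (hH : 0 < H) (hz : z ^ 2 ≤ 1) :
    HasDerivAt (pole κ τ H) (-(Complex.I * (2 * κ * (H ^ 2 + τ ^ 2) / τ * scale κ τ H z ^ 3 : ℝ)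
      * Complex.exp (Complex.I * phase κ τ H z))) z := by
  have h1 := (hasDerivAt_scale (τ := τ) hκ hH hz).ofReal_comp
  have h2 : HasDerivAt (fun z : ℝ => 2 * ((H : ℂ) - Complex.I * (τ * z)))
      (2 * -(Complex.I * τ)) z := by
    have := (((hasDerivAt_id z).ofReal_comp.const_mul (τ : ℂ)).const_mul Complex.I).const_sub
      (H : ℂ)
    simpa using this.const_mul 2
  have := (h1.mul h2).mul (hasDerivAt_exp_phase hκ hτ hH hz)
  refine this.congr_deriv ?_
  have hs := scale_sq_mul_denom (τ := τ) hκ hH hz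
  unfold denom at hs
  set s := scale κ τ H z
  have hs' : (s : ℂ) ^ 2 * (4 * H ^ 2 + κ + (4 * τ ^ 2 - κ) * z ^ 2) = 1 := by
    exact_mod_cast hs
  have hτ' : (τ : ℂ) ≠ 0 := by exact_mod_cast hτ
  simp only [Pi.mul_apply]
  set E := Complex.exp (Complex.I * phase κ τ H z)
  push_cast
  rw [← sub_eq_zero]
  field_simp
  linear_combination (2 * τ ^ 2 * Complex.I * s * E) * hs'
    - (2 * s ^ 3 * z * H * (4 * τ ^ 2 - κ) * τ * E) * Complex.I_sq

end

/-! ### Linear algebra of `ℂ²` -/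

theorem inner_C2 (X Y : C2) : inner ℝ X Y = (X 0).re * (Y 0).re + (X 0).im * (Y 0).im
    + (X 1).re * (Y 1).re + (X 1).im * (Y 1).im := by
  have h : inner ℝ X Y = (inner ℂ X Y).re := rfl
  rw [h, PiLp.inner_apply, Fin.sum_univ_two]
  simp
  ring

@[simp] theorem V_apply (p : C2) (i : Fin 2) : V p i = Complex.I * p i := rfl

theorem inner_V_V (X Y : C2) : inner ℝ (V X) (V Y) = inner ℝ X Y := by
  simp only [inner_C2, V_apply, Complex.mul_re, Complex.mul_im, Complex.I_re, Complex.I_im]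
  ring

theorem inner_V_right (X Y : C2) : inner ℝ X (V Y) = -inner ℝ Y (V X) := by
  simp only [inner_C2, V_apply, Complex.mul_re, Complex.mul_im, Complex.I_re, Complex.I_im]
  ring

theorem inner_V_self (X : C2) : inner ℝ X (V X) = 0 := by
  have := inner_V_right X X
  linarith

/-- Up to `4/κ` the form is `(|X|² - ⟨X, V⟩²) + (4τ²/κ) ⟨X, V⟩²`, and the bracket is nonnegative by
Cauchy–Schwarz, as `|V| = 1`. -/
theorem metric_self_pos {κ τ : ℝ} (hκ : 0 < κ) (hτ : τ ≠ 0) {p X : C2} (hp : ‖p‖ = 1)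
    (hX : X ≠ 0) : 0 < metric κ τ p X X := by
  have h1 : inner ℝ X (V p) ^ 2 ≤ inner ℝ X X := by
    have := abs_real_inner_le_norm X (V p)
    rw [V, norm_smul, Complex.norm_I, one_mul, hp, mul_one] at this
    rw [real_inner_self_eq_norm_sq, ← sq_abs]
    exact pow_le_pow_left₀ (abs_nonneg _) this 2
  have h2 : 0 < inner ℝ X X := real_inner_self_pos.2 hX
  have h3 : 0 < 4 * τ ^ 2 / κ := by positivity
  have h4 : 0 < inner ℝ X X + (4 * τ ^ 2 / κ - 1) * inner ℝ X (V p) ^ 2 := by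
    rcases (sq_nonneg (inner ℝ X (V p))).eq_or_lt with h | h
    · rw [← h]; simpa using h2
    · nlinarith [mul_pos h3 h]
  have : metric κ τ p X X = 4 / κ * (inner ℝ X X + (4 * τ ^ 2 / κ - 1) * inner ℝ X (V p) ^ 2) := by
    unfold metric; ring
  rw [this]
  positivity

theorem fderiv_metric (κ τ : ℝ) (p X Y Z : C2) :
    fderiv ℝ (fun q => metric κ τ q Y Z) p X = 4 / κ * (4 * τ ^ 2 / κ - 1)
      * (inner ℝ Y (V X) * inner ℝ Z (V p) + inner ℝ Y (V p) * inner ℝ Z (V X)) := by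
  have hV : HasFDerivAt V (Complex.I • ContinuousLinearMap.id ℝ C2) p :=
    (hasFDerivAt_id p).const_smul Complex.I
  have hY := (hasFDerivAt_const Y p).inner ℝ hV
  have hZ := (hasFDerivAt_const Z p).inner ℝ hV
  have h := (((hY.const_mul (4 * τ ^ 2 / κ - 1)).mul hZ).const_add (inner ℝ Y Z)).const_mul (4 / κ)
  have : fderiv ℝ (fun q => metric κ τ q Y Z) p = _ := h.fderiv
  rw [this]
  simp only [smul_apply, add_apply, smul_eq_mul,
    ContinuousLinearMap.comp_apply, ContinuousLinearMap.prod_apply, fderivInnerCLM_apply,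
    zero_apply, inner_zero_left, add_zero, ContinuousLinearMap.id_apply, V]
  ring

/-- `V` is linear and skew-symmetric: the terms containing `⟨Z, V p⟩` cancel and the others double.
-/
theorem christoffel_eq (κ τ : ℝ) (p X Y Z : C2) :
    christoffel κ τ p X Y Z = 4 / κ * (4 * τ ^ 2 / κ - 1)
      * (inner ℝ Y (V p) * inner ℝ Z (V X) + inner ℝ X (V p) * inner ℝ Z (V Y)) := by
  unfold christoffel
  rw [fderiv_metric, fderiv_metric, fderiv_metric, inner_V_right X Y, inner_V_right X Z,
    inner_V_right Y Z]
  ring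

/-- If `M = h I + T` where the mixed discriminant of `I` and `T` vanishes, then the trace
of `I⁻¹ M` is `2h`. -/
theorem trace_inv_mul_of_mixed_eq_zero (A B : Matrix (Fin 2) (Fin 2) ℝ) (h : ℝ)
    (T : Fin 2 → Fin 2 → ℝ) (hdet : A.det ≠ 0) (hB : ∀ i j, B i j = h * A i j + T i j)
    (hT : A 0 0 * T 1 1 + A 1 1 * T 0 0 - A 0 1 * T 1 0 - A 1 0 * T 0 1 = 0) :
    (A⁻¹ * B).trace = 2 * h := by
  rw [Matrix.inv_def, Ring.inverse_eq_inv, Matrix.smul_mul, Matrix.trace_smul,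
    Matrix.adjugate_fin_two, Matrix.trace_fin_two, Matrix.mul_apply, Matrix.mul_apply,
    Fin.sum_univ_two, Fin.sum_univ_two, smul_eq_mul, inv_mul_eq_iff_eq_mul₀ hdet,
    Matrix.det_fin_two]
  simp only [hB, Matrix.of_apply, Matrix.cons_val_zero, Matrix.cons_val_one, Matrix.cons_val',
    Matrix.cons_val_fin_one]
  linear_combination hT

/-! ### The map of the sphere -/

/-- The unit complex number with the argument `phase`. -/
def unit (κ τ H z : ℝ) : ℂ := Complex.exp (Complex.I * phase κ τ H z)

/-- The map of the sphere, written on a neighbourhood of `𝕊²` in `ℝ³`. -/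
def ambientMap (κ τ H : ℝ) (p : EuclideanSpace ℝ (Fin 3)) : C2 :=
  !₂[pole κ τ H (p 2), ((√κ * scale κ τ H (p 2) : ℝ) : ℂ) * (p 0 + Complex.I * p 1)]

/-- The derivative of `ambientMap`. -/
def ambientDeriv (κ τ H : ℝ) (p v : EuclideanSpace ℝ (Fin 3)) : C2 :=
  !₂[-(Complex.I * (2 * κ * (H ^ 2 + τ ^ 2) / τ * scale κ τ H (p 2) ^ 3 : ℝ)
      * unit κ τ H (p 2)) * v 2,
    (√κ * scale κ τ H (p 2) : ℝ) * (v 0 + Complex.I * v 1)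
      - (√κ * (4 * τ ^ 2 - κ) * p 2 * scale κ τ H (p 2) ^ 3 * v 2 : ℝ) * (p 0 + Complex.I * p 1)]

section

variable {κ τ H : ℝ} {p : EuclideanSpace ℝ (Fin 3)}

theorem contDiffAt_unit {z : ℝ} (hκ : 0 < κ) (hτ : τ ≠ 0) (hH : 0 < H) (hz : z ^ 2 ≤ 1) :
    ContDiffAt ℝ ∞ (unit κ τ H) z :=
  (contDiffAt_const.mul
    (Complex.ofRealCLM.contDiff.contDiffAt.comp z (contDiffAt_phase hκ hτ hH hz))).cexp

theorem contDiffAt_pole {z : ℝ} (hκ : 0 < κ) (hτ : τ ≠ 0) (hH : 0 < H) (hz : z ^ 2 ≤ 1) :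
    ContDiffAt ℝ ∞ (pole κ τ H) z := by
  have h1 : ContDiffAt ℝ ∞ (fun z => (scale κ τ H z : ℂ)) z :=
    Complex.ofRealCLM.contDiff.contDiffAt.comp z (contDiffAt_scale hκ hH hz)
  have h2 : ContDiffAt ℝ ∞ (fun z : ℝ => 2 * ((H : ℂ) - Complex.I * (τ * z))) z :=
    contDiffAt_const.mul (contDiffAt_const.sub (contDiffAt_const.mul
      (contDiffAt_const.mul Complex.ofRealCLM.contDiff.contDiffAt)))
  exact (h1.mul h2).mul (contDiffAt_unit hκ hτ hH hz)

theorem contDiffAt_coord (i : Fin 3) : ContDiffAt ℝ ∞ (fun q : EuclideanSpace ℝ (Fin 3) => q i) p :=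
  (EuclideanSpace.proj (𝕜 := ℝ) i).contDiff.contDiffAt

theorem contDiffAt_ofReal_coord (i : Fin 3) :
    ContDiffAt ℝ ∞ (fun q : EuclideanSpace ℝ (Fin 3) => ((q i : ℝ) : ℂ)) p :=
  Complex.ofRealCLM.contDiff.contDiffAt.comp p (contDiffAt_coord i)

theorem contDiffAt_ambientMap (hκ : 0 < κ) (hτ : τ ≠ 0) (hH : 0 < H) (hp : p 2 ^ 2 ≤ 1) :
    ContDiffAt ℝ ∞ (ambientMap κ τ H) p := by
  refine (contDiffAt_piLp 2).2 fun i => ?_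
  fin_cases i
  · exact (contDiffAt_pole hκ hτ hH hp).comp p (contDiffAt_coord 2)
  · exact (Complex.ofRealCLM.contDiff.contDiffAt.comp p (contDiffAt_const.mul
      ((contDiffAt_scale hκ hH hp).comp p (contDiffAt_coord 2)))).mul
      ((contDiffAt_ofReal_coord 0).add (contDiffAt_const.mul (contDiffAt_ofReal_coord 1)))

theorem fderiv_ambientMap (hκ : 0 < κ) (hτ : τ ≠ 0) (hH : 0 < H) (hp : p 2 ^ 2 ≤ 1)
    (v : EuclideanSpace ℝ (Fin 3)) :
    fderiv ℝ (ambientMap κ τ H) p v = ambientDeriv κ τ H p v := by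
  have hd : HasFDerivAt (ambientMap κ τ H) (fderiv ℝ (ambientMap κ τ H) p) p :=
    ((contDiffAt_ambientMap hκ hτ hH hp).differentiableAt (by simp)).hasFDerivAt
  -- Each coordinate is differentiated twice, once as a projection of the whole map and once by its
  -- formula; uniqueness of the derivative identifies the results.
  have hd' (i : Fin 2) := (PiLp.proj (𝕜 := ℝ) 2 (fun _ : Fin 2 => ℂ) i).hasFDerivAt.comp p hd
  have hc (i : Fin 3) : HasFDerivAt (fun q : EuclideanSpace ℝ (Fin 3) => q i)
      (EuclideanSpace.proj (𝕜 := ℝ) i) p := (EuclideanSpace.proj (𝕜 := ℝ) i).hasFDerivAt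
  have hcc (i : Fin 3) : HasFDerivAt (fun q : EuclideanSpace ℝ (Fin 3) => ((q i : ℝ) : ℂ))
      (Complex.ofRealCLM ∘L EuclideanSpace.proj (𝕜 := ℝ) i) p :=
    Complex.ofRealCLM.hasFDerivAt.comp p (hc i)
  have h0 := (hasDerivAt_pole hκ hτ hH hp).hasFDerivAt.comp p (hc 2)
  have h1 := (Complex.ofRealCLM.hasFDerivAt.comp p
    (((hasDerivAt_scale (τ := τ) hκ hH hp).hasFDerivAt.comp p (hc 2)).const_mul √κ)).mul
    ((hcc 0).add ((hcc 1).const_mul Complex.I))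
  ext i
  fin_cases i
  · have := congrArg (fun L => L v) ((hd' 0).unique h0)
    refine Eq.trans this ?_
    simp [ambientDeriv, unit]
    ring
  · have := congrArg (fun L => L v) ((hd' 1).unique h1)
    refine Eq.trans this ?_
    simp [ambientDeriv, unit]
    ring

end

/-! ### The normal field -/

/-- A vector of `ℂ²` on which, up to a multiple of the position, the unit normal depends. -/
def frame (κ τ H z : ℝ) : C2 := !₂[unit κ τ H z, 0]

/-- The unit normal of the sphere. -/
def normalAt (κ τ H : ℝ) (p : EuclideanSpace ℝ (Fin 3)) : C2 :=
  (2 * scale κ τ H (p 2))⁻¹ • frame κ τ H (p 2) - H • ambientMap κ τ H p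
    - ((4 * τ ^ 2 - κ) * p 2 / (4 * τ)) • V (ambientMap κ τ H p)

section

variable {κ τ H : ℝ} {p v w : EuclideanSpace ℝ (Fin 3)}

/-! ### Real coordinates of the map and of its derivative. -/

theorem unit_re (κ τ H z : ℝ) : (unit κ τ H z).re = Real.cos (phase κ τ H z) := by
  rw [unit, mul_comm, Complex.exp_ofReal_mul_I_re]

theorem unit_im (κ τ H z : ℝ) : (unit κ τ H z).im = Real.sin (phase κ τ H z) := by
  rw [unit, mul_comm, Complex.exp_ofReal_mul_I_im]

theorem pole_re (κ τ H z : ℝ) : (pole κ τ H z).re = 2 * scale κ τ H z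
    * (H * Real.cos (phase κ τ H z) + τ * z * Real.sin (phase κ τ H z)) := by
  change ((scale κ τ H z : ℂ) * (2 * (H - Complex.I * (τ * z))) * unit κ τ H z).re = _
  simp [unit_re, unit_im]
  ring

theorem pole_im (κ τ H z : ℝ) : (pole κ τ H z).im = 2 * scale κ τ H z
    * (H * Real.sin (phase κ τ H z) - τ * z * Real.cos (phase κ τ H z)) := by
  change ((scale κ τ H z : ℂ) * (2 * (H - Complex.I * (τ * z))) * unit κ τ H z).im = _
  simp [unit_re, unit_im]
  ring

theorem ambientMap_zero_re : (ambientMap κ τ H p 0).re = 2 * scale κ τ H (p 2)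
    * (H * Real.cos (phase κ τ H (p 2)) + τ * p 2 * Real.sin (phase κ τ H (p 2))) :=
  pole_re _ _ _ _

theorem ambientMap_zero_im : (ambientMap κ τ H p 0).im = 2 * scale κ τ H (p 2)
    * (H * Real.sin (phase κ τ H (p 2)) - τ * p 2 * Real.cos (phase κ τ H (p 2))) :=
  pole_im _ _ _ _

theorem ambientMap_one_re : (ambientMap κ τ H p 1).re = √κ * scale κ τ H (p 2) * p 0 := by
  simp [ambientMap]

theorem ambientMap_one_im : (ambientMap κ τ H p 1).im = √κ * scale κ τ H (p 2) * p 1 := by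
  simp [ambientMap]

theorem ambientDeriv_zero : ambientDeriv κ τ H p v 0 = ((2 * κ * (H ^ 2 + τ ^ 2) / τ
    * scale κ τ H (p 2) ^ 3 * v 2 : ℝ) : ℂ) * (-Complex.I * unit κ τ H (p 2)) := by
  simp [ambientDeriv]
  ring

theorem ambientDeriv_zero_re : (ambientDeriv κ τ H p v 0).re = 2 * κ * (H ^ 2 + τ ^ 2) / τ
    * scale κ τ H (p 2) ^ 3 * v 2 * Real.sin (phase κ τ H (p 2)) := by
  rw [ambientDeriv_zero, Complex.re_ofReal_mul]
  simp [unit_im]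

theorem ambientDeriv_zero_im : (ambientDeriv κ τ H p v 0).im = -(2 * κ * (H ^ 2 + τ ^ 2) / τ
    * scale κ τ H (p 2) ^ 3 * v 2 * Real.cos (phase κ τ H (p 2))) := by
  rw [ambientDeriv_zero, Complex.im_ofReal_mul]
  simp [unit_re]

theorem ambientDeriv_one_re : (ambientDeriv κ τ H p v 1).re = √κ * (scale κ τ H (p 2) * v 0
    - (4 * τ ^ 2 - κ) * p 2 * scale κ τ H (p 2) ^ 3 * v 2 * p 0) := by
  have : ambientDeriv κ τ H p v 1 = (√κ * scale κ τ H (p 2) : ℝ) * (v 0 + Complex.I * v 1)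
      - (√κ * (4 * τ ^ 2 - κ) * p 2 * scale κ τ H (p 2) ^ 3 * v 2 : ℝ)
        * (p 0 + Complex.I * p 1) := rfl
  rw [this, Complex.sub_re, Complex.re_ofReal_mul, Complex.re_ofReal_mul]
  simp
  ring

theorem ambientDeriv_one_im : (ambientDeriv κ τ H p v 1).im = √κ * (scale κ τ H (p 2) * v 1
    - (4 * τ ^ 2 - κ) * p 2 * scale κ τ H (p 2) ^ 3 * v 2 * p 1) := by
  have : ambientDeriv κ τ H p v 1 = (√κ * scale κ τ H (p 2) : ℝ) * (v 0 + Complex.I * v 1)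
      - (√κ * (4 * τ ^ 2 - κ) * p 2 * scale κ τ H (p 2) ^ 3 * v 2 : ℝ)
        * (p 0 + Complex.I * p 1) := rfl
  rw [this, Complex.sub_im, Complex.im_ofReal_mul, Complex.im_ofReal_mul]
  simp
  ring

/-! ### Euclidean inner products between the frame, the position and the tangent vectors. -/

theorem inner_frame (z : ℝ) (X : C2) : inner ℝ (frame κ τ H z) X
    = Real.cos (phase κ τ H z) * (X 0).re + Real.sin (phase κ τ H z) * (X 0).im := by
  simp [inner_C2, frame, unit_re, unit_im]

theorem inner_frame_self (z : ℝ) : inner ℝ (frame κ τ H z) (frame κ τ H z) = 1 := by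
  rw [inner_frame]
  simp only [frame, PiLp.toLp_apply, Matrix.cons_val_zero, unit_re, unit_im]
  linear_combination Real.cos_sq_add_sin_sq (phase κ τ H z)

theorem inner_frame_ambientMap :
    inner ℝ (frame κ τ H (p 2)) (ambientMap κ τ H p) = 2 * scale κ τ H (p 2) * H := by
  rw [inner_frame, ambientMap_zero_re, ambientMap_zero_im]
  linear_combination (2 * scale κ τ H (p 2) * H) * Real.cos_sq_add_sin_sq (phase κ τ H (p 2))

theorem inner_frame_V_ambientMap : inner ℝ (frame κ τ H (p 2)) (V (ambientMap κ τ H p))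
    = 2 * scale κ τ H (p 2) * (τ * p 2) := by
  rw [inner_frame, V_apply]
  simp only [Complex.mul_re, Complex.mul_im, Complex.I_re, Complex.I_im]
  rw [ambientMap_zero_re, ambientMap_zero_im]
  linear_combination (2 * scale κ τ H (p 2) * (τ * p 2))
    * Real.cos_sq_add_sin_sq (phase κ τ H (p 2))

theorem inner_frame_ambientDeriv :
    inner ℝ (frame κ τ H (p 2)) (ambientDeriv κ τ H p v) = 0 := by
  rw [inner_frame, ambientDeriv_zero_re, ambientDeriv_zero_im]
  ring

theorem inner_V_frame_ambientDeriv : inner ℝ (V (frame κ τ H (p 2))) (ambientDeriv κ τ H p v)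
    = -(2 * κ * (H ^ 2 + τ ^ 2) / τ * scale κ τ H (p 2) ^ 3 * v 2) := by
  rw [real_inner_comm, inner_V_right, inner_frame, V_apply]
  simp only [Complex.mul_re, Complex.mul_im, Complex.I_re, Complex.I_im]
  rw [ambientDeriv_zero_re, ambientDeriv_zero_im]
  linear_combination -(2 * κ * (H ^ 2 + τ ^ 2) / τ * scale κ τ H (p 2) ^ 3 * v 2)
    * Real.cos_sq_add_sin_sq (phase κ τ H (p 2))

theorem inner_ambientMap_self (hκ : 0 < κ) (hH : 0 < H)
    (hp : p 0 ^ 2 + p 1 ^ 2 + p 2 ^ 2 = 1) :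
    inner ℝ (ambientMap κ τ H p) (ambientMap κ τ H p) = 1 := by
  have hs := scale_sq_mul_denom (τ := τ) hκ hH (show p 2 ^ 2 ≤ 1 by nlinarith)
  rw [inner_C2, ambientMap_zero_re, ambientMap_zero_im, ambientMap_one_re, ambientMap_one_im]
  unfold denom at hs
  have hk := Real.sq_sqrt hκ.le
  linear_combination (4 * scale κ τ H (p 2) ^ 2 * (H ^ 2 + τ ^ 2 * p 2 ^ 2))
    * Real.cos_sq_add_sin_sq (phase κ τ H (p 2))
    + (scale κ τ H (p 2) ^ 2 * (p 0 ^ 2 + p 1 ^ 2)) * hk + hs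
    + (scale κ τ H (p 2) ^ 2 * κ) * hp

theorem inner_ambientMap_ambientDeriv (hκ : 0 < κ) (hτ : τ ≠ 0) (hH : 0 < H)
    (hp : p 0 ^ 2 + p 1 ^ 2 + p 2 ^ 2 = 1) (hv : p 0 * v 0 + p 1 * v 1 + p 2 * v 2 = 0) :
    inner ℝ (ambientMap κ τ H p) (ambientDeriv κ τ H p v) = 0 := by
  have hs := scale_sq_mul_denom (τ := τ) hκ hH (show p 2 ^ 2 ≤ 1 by nlinarith)
  rw [inner_C2, ambientMap_zero_re, ambientMap_zero_im, ambientMap_one_re, ambientMap_one_im,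
    ambientDeriv_zero_re, ambientDeriv_zero_im, ambientDeriv_one_re, ambientDeriv_one_im]
  unfold denom at hs
  have hk := Real.sq_sqrt hκ.le
  set s := scale κ τ H (p 2)
  have e : 2 * κ * (H ^ 2 + τ ^ 2) / τ * τ = 2 * κ * (H ^ 2 + τ ^ 2) := div_mul_cancel₀ _ hτ
  linear_combination (2 * s ^ 4 * p 2 * v 2 * (2 * κ * (H ^ 2 + τ ^ 2) / τ * τ))
    * Real.cos_sq_add_sin_sq (phase κ τ H (p 2)) + 2 * s ^ 4 * p 2 * v 2 * e
    + s ^ 2 * (p 0 * v 0 + p 1 * v 1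
      - (4 * τ ^ 2 - κ) * p 2 * s ^ 2 * v 2 * (p 0 ^ 2 + p 1 ^ 2)) * hk
    + κ * s ^ 2 * hv - κ * s ^ 4 * (4 * τ ^ 2 - κ) * p 2 * v 2 * hp + κ * s ^ 2 * p 2 * v 2 * hs

theorem inner_ambientDeriv_V_ambientMap (hκ : 0 < κ) :
    inner ℝ (ambientDeriv κ τ H p v) (V (ambientMap κ τ H p))
      = κ * scale κ τ H (p 2) ^ 2 * (p 0 * v 1 - p 1 * v 0)
        - 4 * H * scale κ τ H (p 2) ^ 2
          * (κ * (H ^ 2 + τ ^ 2) / τ * scale κ τ H (p 2) ^ 2 * v 2) := by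
  rw [inner_C2]
  simp only [V_apply, Complex.mul_re, Complex.mul_im, Complex.I_re, Complex.I_im]
  rw [ambientMap_zero_re, ambientMap_zero_im, ambientMap_one_re, ambientMap_one_im,
    ambientDeriv_zero_re, ambientDeriv_zero_im, ambientDeriv_one_re, ambientDeriv_one_im]
  have hk := Real.sq_sqrt hκ.le
  set s := scale κ τ H (p 2)
  linear_combination (-(4 * H * s ^ 4 * (κ * (H ^ 2 + τ ^ 2) / τ) * v 2))
    * Real.cos_sq_add_sin_sq (phase κ τ H (p 2))
    + s ^ 2 * (p 0 * v 1 - p 1 * v 0) * hk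

/-- The factor `1 - p 2 ^ 2` lets the induced metric be written with the two one-forms `p₀ dp₁ - p₁
dp₀` and `dp₂`, which are a basis of the cotangent plane away from the poles. -/
theorem inner_ambientDeriv_ambientDeriv (hκ : 0 < κ) (hτ : τ ≠ 0) (hH : 0 < H)
    (hp : p 0 ^ 2 + p 1 ^ 2 + p 2 ^ 2 = 1) (hv : p 0 * v 0 + p 1 * v 1 + p 2 * v 2 = 0)
    (hw : p 0 * w 0 + p 1 * w 1 + p 2 * w 2 = 0) :
    (1 - p 2 ^ 2) * inner ℝ (ambientDeriv κ τ H p v) (ambientDeriv κ τ H p w)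
      = κ * scale κ τ H (p 2) ^ 2 * (p 0 * v 1 - p 1 * v 0) * (p 0 * w 1 - p 1 * w 0)
        + 4 / κ * (1 - 4 * H ^ 2 * scale κ τ H (p 2) ^ 2)
          * (κ * (H ^ 2 + τ ^ 2) / τ * scale κ τ H (p 2) ^ 2 * v 2)
          * (κ * (H ^ 2 + τ ^ 2) / τ * scale κ τ H (p 2) ^ 2 * w 2) := by
  have hs := scale_sq_mul_denom (τ := τ) hκ hH (show p 2 ^ 2 ≤ 1 by nlinarith)
  rw [inner_C2]
  rw [ambientDeriv_zero_re, ambientDeriv_zero_im, ambientDeriv_one_re, ambientDeriv_one_im,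
    ambientDeriv_zero_re, ambientDeriv_zero_im, ambientDeriv_one_re, ambientDeriv_one_im]
  have hk := Real.sq_sqrt hκ.le
  unfold denom at hs
  set s := scale κ τ H (p 2)
  obtain ⟨m, hm⟩ : ∃ m, m = (H ^ 2 + τ ^ 2) / τ := ⟨_, rfl⟩
  have hmτ : m * τ = H ^ 2 + τ ^ 2 := by rw [hm, div_mul_cancel₀ _ hτ]
  have hv' : p 2 * v 2 = -(p 0 * v 0 + p 1 * v 1) := by linarith
  have hw' : p 2 * w 2 = -(p 0 * w 0 + p 1 * w 1) := by linarith
  -- Lagrange's identity in the plane, with the dot products replaced by means of tangency.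
  have e1 : (p 0 ^ 2 + p 1 ^ 2) * (v 0 * w 0 + v 1 * w 1)
      = (p 0 * v 1 - p 1 * v 0) * (p 0 * w 1 - p 1 * w 0) + p 2 ^ 2 * v 2 * w 2 := by
    rw [show p 2 ^ 2 * v 2 * w 2 = (p 2 * v 2) * (p 2 * w 2) by ring, hv', hw']
    ring
  have e2 : (1 - p 2 ^ 2) * ((s * v 0 - (4 * τ ^ 2 - κ) * p 2 * s ^ 3 * v 2 * p 0)
        * (s * w 0 - (4 * τ ^ 2 - κ) * p 2 * s ^ 3 * w 2 * p 0)
      + (s * v 1 - (4 * τ ^ 2 - κ) * p 2 * s ^ 3 * v 2 * p 1)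
        * (s * w 1 - (4 * τ ^ 2 - κ) * p 2 * s ^ 3 * w 2 * p 1))
      = s ^ 2 * (p 0 * v 1 - p 1 * v 0) * (p 0 * w 1 - p 1 * w 0)
        + s ^ 2 * p 2 ^ 2 * v 2 * w 2 * (4 * s ^ 2 * (H ^ 2 + τ ^ 2)) ^ 2 := by
    have h4 : 4 * s ^ 2 * (H ^ 2 + τ ^ 2) = 1 + (4 * τ ^ 2 - κ) * s ^ 2 * (1 - p 2 ^ 2) := by
      linear_combination hs
    rw [h4, show 1 - p 2 ^ 2 = p 0 ^ 2 + p 1 ^ 2 by linarith]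
    linear_combination s ^ 2 * e1
      - (p 0 ^ 2 + p 1 ^ 2) * s ^ 4 * (4 * τ ^ 2 - κ) * (p 2 * v 2) * hw
      - (p 0 ^ 2 + p 1 ^ 2) * s ^ 4 * (4 * τ ^ 2 - κ) * (p 2 * w 2) * hv
  have hms : 2 * κ * (H ^ 2 + τ ^ 2) / τ = 2 * κ * m := by rw [hm]; ring
  have hms' : κ * (H ^ 2 + τ ^ 2) / τ = κ * m := by rw [hm]; ring
  rw [hms, hms']
  have e3 : 4 / κ * (1 - 4 * H ^ 2 * s ^ 2) * (κ * m * s ^ 2 * v 2) * (κ * m * s ^ 2 * w 2)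
      = 4 * κ * (1 - 4 * H ^ 2 * s ^ 2) * (m * s ^ 2 * v 2) * (m * s ^ 2 * w 2) := by
    field_simp
  rw [e3]
  rw [← hmτ] at e2
  linear_combination κ * e2 + (1 - p 2 ^ 2) * ((s * v 0 - (4 * τ ^ 2 - κ) * p 2 * s ^ 3 * v 2 * p 0)
        * (s * w 0 - (4 * τ ^ 2 - κ) * p 2 * s ^ 3 * w 2 * p 0)
      + (s * v 1 - (4 * τ ^ 2 - κ) * p 2 * s ^ 3 * v 2 * p 1)
        * (s * w 1 - (4 * τ ^ 2 - κ) * p 2 * s ^ 3 * w 2 * p 1)) * hk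
    + (1 - p 2 ^ 2) * 4 * κ ^ 2 * m ^ 2 * s ^ 6 * v 2 * w 2
      * Real.cos_sq_add_sin_sq (phase κ τ H (p 2))
    + 4 * κ * m ^ 2 * s ^ 4 * v 2 * w 2 * hs

/-! ### Properties of the normal -/

theorem inner_normalAt (X : C2) : inner ℝ (normalAt κ τ H p) X
    = (2 * scale κ τ H (p 2))⁻¹ * inner ℝ (frame κ τ H (p 2)) X
      - H * inner ℝ (ambientMap κ τ H p) X
      - (4 * τ ^ 2 - κ) * p 2 / (4 * τ) * inner ℝ (V (ambientMap κ τ H p)) X := by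
  rw [normalAt, inner_sub_left, inner_sub_left, real_inner_smul_left, real_inner_smul_left,
    real_inner_smul_left]

theorem inner_normalAt_ambientMap (hκ : 0 < κ) (hH : 0 < H)
    (hp : p 0 ^ 2 + p 1 ^ 2 + p 2 ^ 2 = 1) :
    inner ℝ (normalAt κ τ H p) (ambientMap κ τ H p) = 0 := by
  have hs := scale_pos (τ := τ) hκ hH (show p 2 ^ 2 ≤ 1 by nlinarith)
  rw [inner_normalAt, inner_frame_ambientMap, inner_ambientMap_self hκ hH hp, real_inner_comm,
    inner_V_self]
  field_simp
  ring

theorem inner_normalAt_V_ambientMap (hκ : 0 < κ) (hτ : τ ≠ 0) (hH : 0 < H)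
    (hp : p 0 ^ 2 + p 1 ^ 2 + p 2 ^ 2 = 1) :
    inner ℝ (normalAt κ τ H p) (V (ambientMap κ τ H p)) = κ * p 2 / (4 * τ) := by
  have hs := scale_pos (τ := τ) hκ hH (show p 2 ^ 2 ≤ 1 by nlinarith)
  rw [inner_normalAt, inner_frame_V_ambientMap, inner_V_V, inner_ambientMap_self hκ hH hp,
    inner_V_self]
  field_simp
  ring

/-- The coefficient of `V` in `normalAt` is chosen so that it cancels the anisotropic term of the
metric, leaving an expression whose second-derivative terms are easy to find. -/
theorem metric_normalAt (hκ : 0 < κ) (hτ : τ ≠ 0) (hH : 0 < H)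
    (hp : p 0 ^ 2 + p 1 ^ 2 + p 2 ^ 2 = 1) (X : C2) :
    metric κ τ (ambientMap κ τ H p) X (normalAt κ τ H p)
      = 4 / κ * ((2 * scale κ τ H (p 2))⁻¹ * inner ℝ (frame κ τ H (p 2)) X
        - H * inner ℝ (ambientMap κ τ H p) X) := by
  rw [metric, inner_normalAt_V_ambientMap hκ hτ hH hp, real_inner_comm, inner_normalAt,
    real_inner_comm X (V _)]
  field_simp
  ring

theorem metric_normalAt_self (hκ : 0 < κ) (hτ : τ ≠ 0) (hH : 0 < H)
    (hp : p 0 ^ 2 + p 1 ^ 2 + p 2 ^ 2 = 1) :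
    metric κ τ (ambientMap κ τ H p) (normalAt κ τ H p) (normalAt κ τ H p) = 1 := by
  have hz : p 2 ^ 2 ≤ 1 := by nlinarith
  have hs := scale_pos (τ := τ) hκ hH hz
  have hs2 := scale_sq_mul_denom (τ := τ) hκ hH hz
  rw [metric_normalAt hκ hτ hH hp, real_inner_comm (normalAt κ τ H p) (ambientMap κ τ H p),
    inner_normalAt_ambientMap hκ hH hp, real_inner_comm, inner_normalAt, inner_frame_self,
    real_inner_comm, inner_frame_ambientMap, real_inner_comm, inner_frame_V_ambientMap]
  unfold denom at hs2
  field_simp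
  linear_combination -4 * hs2

theorem metric_ambientDeriv_normalAt (hκ : 0 < κ) (hτ : τ ≠ 0) (hH : 0 < H)
    (hp : p 0 ^ 2 + p 1 ^ 2 + p 2 ^ 2 = 1) (hv : p 0 * v 0 + p 1 * v 1 + p 2 * v 2 = 0) :
    metric κ τ (ambientMap κ τ H p) (ambientDeriv κ τ H p v) (normalAt κ τ H p) = 0 := by
  rw [metric_normalAt hκ hτ hH hp, inner_frame_ambientDeriv,
    inner_ambientMap_ambientDeriv hκ hτ hH hp hv]
  ring

theorem inner_normalAt_V_ambientDeriv (hκ : 0 < κ) (hτ : τ ≠ 0) (hH : 0 < H)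
    (hp : p 0 ^ 2 + p 1 ^ 2 + p 2 ^ 2 = 1) (hv : p 0 * v 0 + p 1 * v 1 + p 2 * v 2 = 0) :
    inner ℝ (normalAt κ τ H p) (V (ambientDeriv κ τ H p v))
      = κ * (H ^ 2 + τ ^ 2) / τ * scale κ τ H (p 2) ^ 2 * v 2
        + H * inner ℝ (ambientDeriv κ τ H p v) (V (ambientMap κ τ H p)) := by
  have hs := scale_pos (τ := τ) hκ hH (show p 2 ^ 2 ≤ 1 by nlinarith)
  rw [inner_normalAt, inner_V_V, inner_ambientMap_ambientDeriv hκ hτ hH hp hv,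
    inner_V_right (frame κ τ H (p 2)), real_inner_comm, inner_V_frame_ambientDeriv,
    inner_V_right (ambientMap κ τ H p)]
  field_simp
  ring

end

/-! ### The mean curvature -/

section

variable {κ τ H : ℝ}

theorem hasDerivAt_frame {z : ℝ} (hκ : 0 < κ) (hτ : τ ≠ 0) (hH : 0 < H) (hz : z ^ 2 ≤ 1) :
    HasDerivAt (frame κ τ H)
      ((H / τ * (4 * τ ^ 2 - κ) * scale κ τ H z ^ 2) • V (frame κ τ H z)) z := by
  have h : frame κ τ H = fun z => unit κ τ H z • (!₂[1, 0] : C2) := by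
    funext z
    ext i
    fin_cases i <;> simp [frame]
  rw [h]
  refine ((hasDerivAt_exp_phase hκ hτ hH hz).smul_const (!₂[1, 0] : C2)).congr_deriv ?_
  ext i
  fin_cases i <;> simp [unit]
  ring

theorem sq_coord_le_one {p : EuclideanSpace ℝ (Fin 3)}
    (hp : p 0 ^ 2 + p 1 ^ 2 + p 2 ^ 2 = 1) : p 2 ^ 2 ≤ 1 := by
  nlinarith [sq_nonneg (p 0), sq_nonneg (p 1)]

variable {ψ : EuclideanSpace ℝ (Fin 2) → EuclideanSpace ℝ (Fin 3)}
  {s : Set (EuclideanSpace ℝ (Fin 2))} {u : EuclideanSpace ℝ (Fin 2)}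

theorem fderiv_tangent (hs : IsOpen s) (hψ : ContDiffOn ℝ ∞ ψ s)
    (hS : ∀ v, ψ v 0 ^ 2 + ψ v 1 ^ 2 + ψ v 2 ^ 2 = 1) (hu : u ∈ s)
    (w : EuclideanSpace ℝ (Fin 2)) : ψ u 0 * fderiv ℝ ψ u w 0 + ψ u 1 * fderiv ℝ ψ u w 1
      + ψ u 2 * fderiv ℝ ψ u w 2 = 0 := by
  have hd : HasFDerivAt ψ (fderiv ℝ ψ u) u :=
    ((hψ.contDiffAt (hs.mem_nhds hu)).differentiableAt (by simp)).hasFDerivAt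
  have hc (i : Fin 3) := (EuclideanSpace.proj (𝕜 := ℝ) i).hasFDerivAt.comp u hd
  have h := (((hc 0).pow 2).add ((hc 1).pow 2)).add ((hc 2).pow 2)
  have h' : HasFDerivAt (fun v => ψ v 0 ^ 2 + ψ v 1 ^ 2 + ψ v 2 ^ 2)
      (0 : EuclideanSpace ℝ (Fin 2) →L[ℝ] ℝ) u := by
    simp only [hS]
    exact hasFDerivAt_const _ _
  have := congrArg (fun L => L w) (h.unique h')
  simp at this
  linarith

theorem pd_ambientMap_comp (hκ : 0 < κ) (hτ : τ ≠ 0) (hH : 0 < H) (hs : IsOpen s)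
    (hψ : ContDiffOn ℝ ∞ ψ s) (hS : ∀ v, ψ v 0 ^ 2 + ψ v 1 ^ 2 + ψ v 2 ^ 2 = 1) (hu : u ∈ s)
    (i : Fin 2) : pd i (fun v => ambientMap κ τ H (ψ v)) u
      = ambientDeriv κ τ H (ψ u) (fderiv ℝ ψ u (EuclideanSpace.single i 1)) := by
  have hd : DifferentiableAt ℝ ψ u :=
    (hψ.contDiffAt (hs.mem_nhds hu)).differentiableAt (by simp)
  have hz := sq_coord_le_one (hS u)
  have hF : DifferentiableAt ℝ (ambientMap κ τ H) (ψ u) :=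
    (contDiffAt_ambientMap hκ hτ hH hz).differentiableAt (by simp)
  rw [pd, ← fderiv_ambientMap hκ hτ hH hz]
  exact congrArg (fun L => L (EuclideanSpace.single i 1)) (fderiv_comp u hF hd)

/-- Applied with `g` a first partial derivative and `f` the position or `frame`, this trades second
derivatives of the map for first ones. -/
theorem inner_fderiv_add_inner_fderiv_eq_zero {E G : Type*} [NormedAddCommGroup E]
    [NormedSpace ℝ E] [NormedAddCommGroup G] [InnerProductSpace ℝ G] {f g : E → G} {f' : E →L[ℝ] G}
    {x : E} (hf : HasFDerivAt f f' x) (hg : DifferentiableAt ℝ g x)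
    (h : ∀ᶠ v in nhds x, inner ℝ (f v) (g v) = 0) (w : E) :
    inner ℝ (f x) (fderiv ℝ g x w) + inner ℝ (f' w) (g x) = 0 := by
  have h1 := hf.inner ℝ hg.hasFDerivAt
  have h2 : HasFDerivAt (fun v => inner ℝ (f v) (g v)) (0 : E →L[ℝ] ℝ) x :=
    (hasFDerivAt_const (0 : ℝ) x).congr_of_eventuallyEq h
  have := congrArg (fun L => L w) (h1.unique h2)
  simpa using this

theorem differentiableAt_pd (hκ : 0 < κ) (hτ : τ ≠ 0) (hH : 0 < H) (hs : IsOpen s)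
    (hψ : ContDiffOn ℝ ∞ ψ s) (hS : ∀ v, ψ v 0 ^ 2 + ψ v 1 ^ 2 + ψ v 2 ^ 2 = 1) (hu : u ∈ s)
    (j : Fin 2) : DifferentiableAt ℝ (pd j fun v => ambientMap κ τ H (ψ v)) u := by
  have h : ContDiffAt ℝ ∞ (fun v => ambientMap κ τ H (ψ v)) u :=
    (contDiffAt_ambientMap hκ hτ hH (sq_coord_le_one (hS u))).comp u
      (hψ.contDiffAt (hs.mem_nhds hu))
  have h2 : ContDiffAt ℝ ∞ (fderiv ℝ fun v => ambientMap κ τ H (ψ v)) u :=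
    h.fderiv_right (m := ∞) (by simp)
  exact (h2.differentiableAt (by simp)).clm_apply (differentiableAt_const _)

theorem inner_ambientMap_pd_pd (hκ : 0 < κ) (hτ : τ ≠ 0) (hH : 0 < H) (hs : IsOpen s)
    (hψ : ContDiffOn ℝ ∞ ψ s) (hS : ∀ v, ψ v 0 ^ 2 + ψ v 1 ^ 2 + ψ v 2 ^ 2 = 1) (hu : u ∈ s)
    (i j : Fin 2) :
    inner ℝ (ambientMap κ τ H (ψ u)) (pd i (pd j fun v => ambientMap κ τ H (ψ v)) u)
      = -inner ℝ (pd i (fun v => ambientMap κ τ H (ψ v)) u)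
        (pd j (fun v => ambientMap κ τ H (ψ v)) u) := by
  have hd : DifferentiableAt ℝ (fun v => ambientMap κ τ H (ψ v)) u :=
    ((contDiffAt_ambientMap hκ hτ hH (sq_coord_le_one (hS u))).comp u
      (hψ.contDiffAt (hs.mem_nhds hu))).differentiableAt (by simp)
  refine eq_neg_of_add_eq_zero_left (inner_fderiv_add_inner_fderiv_eq_zero hd.hasFDerivAt
    (differentiableAt_pd hκ hτ hH hs hψ hS hu j) ?_ _)
  filter_upwards [hs.mem_nhds hu] with v hv
  rw [pd_ambientMap_comp hκ hτ hH hs hψ hS hv]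
  exact inner_ambientMap_ambientDeriv hκ hτ hH (hS v) (fderiv_tangent hs hψ hS hv _)

theorem inner_frame_pd_pd (hκ : 0 < κ) (hτ : τ ≠ 0) (hH : 0 < H) (hs : IsOpen s)
    (hψ : ContDiffOn ℝ ∞ ψ s) (hS : ∀ v, ψ v 0 ^ 2 + ψ v 1 ^ 2 + ψ v 2 ^ 2 = 1) (hu : u ∈ s)
    (i j : Fin 2) :
    inner ℝ (frame κ τ H (ψ u 2)) (pd i (pd j fun v => ambientMap κ τ H (ψ v)) u)
      = H / τ * (4 * τ ^ 2 - κ) * scale κ τ H (ψ u 2) ^ 2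
        * fderiv ℝ ψ u (EuclideanSpace.single i 1) 2
        * (2 * κ * (H ^ 2 + τ ^ 2) / τ * scale κ τ H (ψ u 2) ^ 3
          * fderiv ℝ ψ u (EuclideanSpace.single j 1) 2) := by
  have hd : HasFDerivAt ψ (fderiv ℝ ψ u) u :=
    ((hψ.contDiffAt (hs.mem_nhds hu)).differentiableAt (by simp)).hasFDerivAt
  have hfr := (hasDerivAt_frame hκ hτ hH (sq_coord_le_one (hS u))).hasFDerivAt.comp u
    ((EuclideanSpace.proj (𝕜 := ℝ) (2 : Fin 3)).hasFDerivAt.comp u hd)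
  have h := inner_fderiv_add_inner_fderiv_eq_zero hfr
    (differentiableAt_pd hκ hτ hH hs hψ hS hu j) (by
      filter_upwards [hs.mem_nhds hu] with v hv
      rw [pd_ambientMap_comp hκ hτ hH hs hψ hS hv]
      exact inner_frame_ambientDeriv) (EuclideanSpace.single i 1)
  refine (eq_neg_of_add_eq_zero_left h).trans ?_
  rw [pd_ambientMap_comp hκ hτ hH hs hψ hS hu]
  simp only [ContinuousLinearMap.comp_apply, ContinuousLinearMap.toSpanSingleton_apply,
    real_inner_smul_left]
  have := inner_V_frame_ambientDeriv (κ := κ) (τ := τ) (H := H) (p := ψ u)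
    (v := fderiv ℝ ψ u (EuclideanSpace.single j 1))
  rw [this]
  simp only [EuclideanSpace.coe_proj]
  ring

theorem ambientDeriv_add (p v w : EuclideanSpace ℝ (Fin 3)) :
    ambientDeriv κ τ H p (v + w) = ambientDeriv κ τ H p v + ambientDeriv κ τ H p w := by
  ext i
  fin_cases i <;> simp [ambientDeriv] <;> ring

theorem ambientDeriv_smul (p v : EuclideanSpace ℝ (Fin 3)) (c : ℝ) :
    ambientDeriv κ τ H p (c • v) = c • ambientDeriv κ τ H p v := by
  ext i
  fin_cases i <;> simp [ambientDeriv] <;> ring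

/-- Pairing with `V frame` recovers `v 2`; once this vanishes, the second coordinate is a nonzero
multiple of `v 0 + i v 1`. -/
theorem eq_zero_of_ambientDeriv_eq_zero (hκ : 0 < κ) (hτ : τ ≠ 0) (hH : 0 < H)
    {p v : EuclideanSpace ℝ (Fin 3)} (hp : p 2 ^ 2 ≤ 1) (h : ambientDeriv κ τ H p v = 0) :
    v = 0 := by
  have hs := scale_pos (τ := τ) hκ hH hp
  have hk := Real.sqrt_pos.2 hκ
  have h2 : v 2 = 0 := by
    have := inner_V_frame_ambientDeriv (κ := κ) (τ := τ) (H := H) (p := p) (v := v)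
    rw [h, inner_zero_right, eq_comm, neg_eq_zero] at this
    have hne : 2 * κ * (H ^ 2 + τ ^ 2) / τ * scale κ τ H (p 2) ^ 3 ≠ 0 := by positivity
    exact (mul_eq_zero.1 this).resolve_left hne
  have e0 := ambientDeriv_one_re (κ := κ) (τ := τ) (H := H) (p := p) (v := v)
  have e1 := ambientDeriv_one_im (κ := κ) (τ := τ) (H := H) (p := p) (v := v)
  simp [h, h2, hk.ne', hs.ne'] at e0 e1
  ext i
  fin_cases i <;> simp [e0, e1, h2]

theorem meanCurvature_ambientMap (hκ : 0 < κ) (hτ : τ ≠ 0) (hH : 0 < H) (hs : IsOpen s)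
    (hψ : ContDiffOn ℝ ∞ ψ s) (hS : ∀ v, ψ v 0 ^ 2 + ψ v 1 ^ 2 + ψ v 2 ^ 2 = 1) (hu : u ∈ s)
    (hinj : Function.Injective (fderiv ℝ ψ u)) :
    meanCurvature κ τ (fun v => ambientMap κ τ H (ψ v)) (normalAt κ τ H (ψ u)) u = H := by
  set p := ψ u with hpdef
  set W : Fin 2 → EuclideanSpace ℝ (Fin 3) := fun i => fderiv ℝ ψ u (EuclideanSpace.single i 1)
    with hW
  have hp : p 0 ^ 2 + p 1 ^ 2 + p 2 ^ 2 = 1 := hS u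
  have hz := sq_coord_le_one hp
  have hWp (i : Fin 2) : p 0 * W i 0 + p 1 * W i 1 + p 2 * W i 2 = 0 :=
    fderiv_tangent hs hψ hS hu _
  have hpd (i : Fin 2) : pd i (fun v => ambientMap κ τ H (ψ v)) u = ambientDeriv κ τ H p (W i) :=
    pd_ambientMap_comp hκ hτ hH hs hψ hS hu i
  have hc := scale_pos (τ := τ) hκ hH hz
  have hcD := scale_sq_mul_denom (τ := τ) hκ hH hz
  unfold denom at hcD
  set c := scale κ τ H (p 2) with hcdef
  set α : Fin 2 → ℝ := fun i => p 0 * W i 1 - p 1 * W i 0 with hα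
  set ξ : Fin 2 → ℝ := fun i => κ * (H ^ 2 + τ ^ 2) / τ * c ^ 2 * W i 2 with hξ
  set η : Fin 2 → ℝ := fun i => κ * c ^ 2 * α i - 4 * H * c ^ 2 * ξ i with hη
  have hηX (i : Fin 2) : inner ℝ (ambientDeriv κ τ H p (W i)) (V (ambientMap κ τ H p)) = η i :=
    inner_ambientDeriv_V_ambientMap hκ
  set A := firstForm κ τ (fun v => ambientMap κ τ H (ψ v)) u with hA
  have hAij (i j : Fin 2) : A i j = 4 / κ * (inner ℝ (ambientDeriv κ τ H p (W i))
      (ambientDeriv κ τ H p (W j)) + (4 * τ ^ 2 / κ - 1) * η i * η j) := by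
    simp only [hA, firstForm, Matrix.of_apply, hpd, metric]
    rw [hηX, hηX]
  have hSpos : 0 < H ^ 2 + τ ^ 2 := by positivity
  have key : ((A)⁻¹ * secondForm κ τ (fun v => ambientMap κ τ H (ψ v)) (normalAt κ τ H p) u).trace
      = 2 * H := by
    refine trace_inv_mul_of_mixed_eq_zero _ _ H (fun i j => 4 * (4 * τ ^ 2 - κ) / κ ^ 2
      * (H * η i * η j + η i * ξ j + ξ i * η j + H / (H ^ 2 + τ ^ 2) * ξ i * ξ j)) ?_ ?_ ?_
    -- A null vector of the Gram matrix gives a nonzero parameter direction whose image has length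
    -- zero, against `metric_self_pos` and injectivity.
    · intro hdet
      obtain ⟨x, hx0, hx⟩ := Matrix.exists_mulVec_eq_zero_iff.2 hdet
      have hx2 : x 0 * (A 0 0 * x 0 + A 0 1 * x 1) + x 1 * (A 1 0 * x 0 + A 1 1 * x 1) = 0 := by
        have h0 := congrFun hx 0
        have h1 := congrFun hx 1
        simp only [Matrix.mulVec, dotProduct, Fin.sum_univ_two, Pi.zero_apply] at h0 h1
        rw [h0, h1]; ring
      set w : EuclideanSpace ℝ (Fin 2) :=
        x 0 • EuclideanSpace.single 0 1 + x 1 • EuclideanSpace.single 1 1 with hw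
      have hXw : ambientDeriv κ τ H p (fderiv ℝ ψ u w)
          = x 0 • ambientDeriv κ τ H p (W 0) + x 1 • ambientDeriv κ τ H p (W 1) := by
        rw [hw, map_add, map_smul, map_smul, ambientDeriv_add, ambientDeriv_smul,
          ambientDeriv_smul]
      have hm : metric κ τ (ambientMap κ τ H p) (ambientDeriv κ τ H p (fderiv ℝ ψ u w))
          (ambientDeriv κ τ H p (fderiv ℝ ψ u w)) = 0 := by
        rw [← hx2, hXw, metric]
        simp only [hAij, inner_add_left, inner_add_right, real_inner_smul_left,
          real_inner_smul_right, hηX]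
        ring
      have hw0 : w ≠ 0 := by
        intro h0
        apply hx0
        have h1 := congrArg (fun q : EuclideanSpace ℝ (Fin 2) => q 0) h0
        have h2 := congrArg (fun q : EuclideanSpace ℝ (Fin 2) => q 1) h0
        simp [hw] at h1 h2
        ext i
        fin_cases i <;> simp [h1, h2]
      refine (metric_self_pos hκ hτ ?_ ?_).ne' hm
      · have := inner_ambientMap_self (τ := τ) hκ hH hp
        rw [real_inner_self_eq_norm_sq] at this
        exact (pow_eq_one_iff_of_nonneg (norm_nonneg _) two_ne_zero).1 this
      · intro h
        exact hw0 (hinj (by rw [eq_zero_of_ambientDeriv_eq_zero hκ hτ hH hz h, map_zero]))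
    · intro i j
      simp only [secondForm, Matrix.of_apply, hpd]
      rw [metric_normalAt hκ hτ hH hp, inner_ambientMap_pd_pd hκ hτ hH hs hψ hS hu,
        inner_frame_pd_pd hκ hτ hH hs hψ hS hu, christoffel_eq,
        inner_normalAt_V_ambientDeriv hκ hτ hH hp (hWp i),
        inner_normalAt_V_ambientDeriv hκ hτ hH hp (hWp j), hpd, hpd, hηX, hηX, hAij]
      change 4 / κ * ((2 * c)⁻¹ * (H / τ * (4 * τ ^ 2 - κ) * c ^ 2 * W i 2
        * (2 * κ * (H ^ 2 + τ ^ 2) / τ * c ^ 3 * W j 2)) - H * -inner ℝ _ _)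
        + 4 / κ * (4 * τ ^ 2 / κ - 1) * (η j * (ξ i + H * η i) + η i * (ξ j + H * η j)) = _
      have e : (2 * c)⁻¹ * (H / τ * (4 * τ ^ 2 - κ) * c ^ 2 * W i 2
        * (2 * κ * (H ^ 2 + τ ^ 2) / τ * c ^ 3 * W j 2))
        = (4 * τ ^ 2 - κ) / κ * (H / (H ^ 2 + τ ^ 2) * ξ i * ξ j) := by
        simp only [hξ]
        field_simp
      rw [e]
      field_simp
      ring
    -- At the poles tangent vectors are horizontal, so `ξ` and `η` vanish and the correction term is
    -- zero.
    · by_cases hρ : 1 - p 2 ^ 2 = 0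
      · have h0 : p 0 = 0 := by nlinarith [sq_nonneg (p 0), sq_nonneg (p 1)]
        have h1 : p 1 = 0 := by nlinarith [sq_nonneg (p 0), sq_nonneg (p 1)]
        have h2 : p 2 ≠ 0 := by
          intro h; rw [h] at hρ; norm_num at hρ
        have hW2 (i : Fin 2) : W i 2 = 0 := by
          have := hWp i
          rw [h0, h1] at this
          simpa [h2] using this
        have hξ0 (i : Fin 2) : ξ i = 0 := by simp only [hξ, hW2, mul_zero]
        have hη0 (i : Fin 2) : η i = 0 := by simp only [hη, hξ0, hα, h0, h1]; ring
        simp [hξ0, hη0]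
      -- Since `η = c² (κ α - 4H ξ)`, the right side equals `16/κ² ((H² + τ²) η² + 2H ηξ + ξ²)`,
      -- read as a symmetric bilinear form.
      · have hρA (i j : Fin 2) : (1 - p 2 ^ 2) * A i j = 4 / κ * (κ * c ^ 2 * α i * α j
            + 4 / κ * (1 - 4 * H ^ 2 * c ^ 2) * ξ i * ξ j
            + (4 * c ^ 2 * (H ^ 2 + τ ^ 2) - 1) * c ^ 2 / κ
              * (κ * α i - 4 * H * ξ i) * (κ * α j - 4 * H * ξ j)) := by
          have h4 : (1 - p 2 ^ 2) * (4 * τ ^ 2 - κ) * c ^ 2 = 4 * c ^ 2 * (H ^ 2 + τ ^ 2) - 1 := by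
            linear_combination -hcD
          have h5 := inner_ambientDeriv_ambientDeriv hκ hτ hH hp (hWp i) (hWp j)
          rw [hAij, ← h4]
          have e : (1 - p 2 ^ 2) * (4 / κ * (inner ℝ (ambientDeriv κ τ H p (W i))
              (ambientDeriv κ τ H p (W j)) + (4 * τ ^ 2 / κ - 1) * η i * η j))
              = 4 / κ * ((1 - p 2 ^ 2) * inner ℝ (ambientDeriv κ τ H p (W i))
              (ambientDeriv κ τ H p (W j)) + (1 - p 2 ^ 2) * (4 * τ ^ 2 / κ - 1) * η i * η j) := by
            ring
          rw [e, h5]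
          change 4 / κ * (κ * c ^ 2 * α i * α j + 4 / κ * (1 - 4 * H ^ 2 * c ^ 2) * ξ i * ξ j
            + (1 - p 2 ^ 2) * (4 * τ ^ 2 / κ - 1) * η i * η j) = _
          simp only [hη]
          field_simp
        refine (mul_eq_zero.1 (?_ : (1 - p 2 ^ 2) * _ = 0)).resolve_left hρ
        have e (r a b c d t₁ t₂ t₃ t₄ : ℝ) : r * (a * t₁ + b * t₂ - c * t₃ - d * t₄)
            = (r * a) * t₁ + (r * b) * t₂ - (r * c) * t₃ - (r * d) * t₄ := by ring
        rw [e, hρA, hρA, hρA, hρA]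
        simp only [hη]
        generalize α 0 = a0, α 1 = a1, ξ 0 = x0, ξ 1 = x1
        field_simp
        ring
  rw [meanCurvature, key]
  ring

end

/-! ### The immersed sphere -/

theorem S2_coord_sq (q : S2) :
    (q : EuclideanSpace ℝ (Fin 3)) 0 ^ 2 + (q : EuclideanSpace ℝ (Fin 3)) 1 ^ 2
      + (q : EuclideanSpace ℝ (Fin 3)) 2 ^ 2 = 1 := by
  have h := q.2
  rw [mem_sphere_zero_iff_norm, EuclideanSpace.norm_eq, Real.sqrt_eq_one] at h
  simpa [Fin.sum_univ_three] using h

theorem norm_ambientMap {κ H : ℝ} (τ : ℝ) (hκ : 0 < κ) (hH : 0 < H)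
    {p : EuclideanSpace ℝ (Fin 3)} (hp : p 0 ^ 2 + p 1 ^ 2 + p 2 ^ 2 = 1) :
    ‖ambientMap κ τ H p‖ = 1 := by
  have := inner_ambientMap_self (τ := τ) hκ hH hp
  rw [real_inner_self_eq_norm_sq] at this
  exact (pow_eq_one_iff_of_nonneg (norm_nonneg _) two_ne_zero).1 this

/-- The immersed sphere. -/
def sphereMap {κ H : ℝ} (τ : ℝ) (hκ : 0 < κ) (hH : 0 < H) : S2 → S3 :=
  Set.codRestrict (fun q : S2 => ambientMap κ τ H q) (Metric.sphere (0 : C2) 1) fun q =>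
    mem_sphere_zero_iff_norm.2 (norm_ambientMap τ hκ hH (S2_coord_sq q))

section

variable {κ τ H : ℝ}

theorem finrank_E3 : Fact (Module.finrank ℝ (EuclideanSpace ℝ (Fin 3)) = 2 + 1) :=
  ⟨finrank_euclideanSpace_fin⟩

theorem contMDiff_coe_S2 : ContMDiff (𝓡 2) 𝓘(ℝ, EuclideanSpace ℝ (Fin 3)) ∞
    (Subtype.val : S2 → EuclideanSpace ℝ (Fin 3)) :=
  have := finrank_E3
  contMDiff_coe_sphere

theorem mdifferentiableAt_coe_S2 (q : S2) : MDifferentiableAt (𝓡 2)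
    𝓘(ℝ, EuclideanSpace ℝ (Fin 3)) (Subtype.val : S2 → EuclideanSpace ℝ (Fin 3)) q :=
  (contMDiff_coe_S2 q).mdifferentiableAt (by simp)

theorem mfderiv_coe_S2_tangent (q : S2) (v : TangentSpace (𝓡 2) q)
    (w : EuclideanSpace ℝ (Fin 3))
    (hw : w = mfderiv (𝓡 2) 𝓘(ℝ, EuclideanSpace ℝ (Fin 3)) (Subtype.val : S2 → EuclideanSpace ℝ (Fin 3)) q v) :
    (q : EuclideanSpace ℝ (Fin 3)) 0 * w 0 + (q : EuclideanSpace ℝ (Fin 3)) 1 * w 1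
      + (q : EuclideanSpace ℝ (Fin 3)) 2 * w 2 = 0 := by
  have := finrank_E3
  have h : w ∈ (mvfderiv (𝓡 2) (Subtype.val : S2 → EuclideanSpace ℝ (Fin 3)) q).range := ⟨v, hw.symm⟩
  rw [range_mvfderiv_subtypeVal, Submodule.mem_orthogonal_singleton_iff_inner_right,
    PiLp.inner_apply, Fin.sum_univ_three] at h
  simp at h
  linarith

theorem contMDiff_ambientMap_coe (hκ : 0 < κ) (hτ : τ ≠ 0) (hH : 0 < H) :
    ContMDiff (𝓡 2) 𝓘(ℝ, C2) ∞ fun q : S2 => ambientMap κ τ H q := fun q =>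
  (contDiffAt_ambientMap hκ hτ hH (sq_coord_le_one (S2_coord_sq q))).contMDiffAt.comp q
    (contMDiff_coe_S2 q)

theorem mfderiv_ambientMap_coe (hκ : 0 < κ) (hτ : τ ≠ 0) (hH : 0 < H) (q : S2)
    (v : TangentSpace (𝓡 2) q) :
    mfderiv (𝓡 2) 𝓘(ℝ, C2) (fun q : S2 => ambientMap κ τ H q) q v
      = ambientDeriv κ τ H q
        (mfderiv (𝓡 2) 𝓘(ℝ, EuclideanSpace ℝ (Fin 3)) (Subtype.val : S2 → EuclideanSpace ℝ (Fin 3)) q v) := by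
  have hz := sq_coord_le_one (S2_coord_sq q)
  have hF : MDifferentiableAt 𝓘(ℝ, EuclideanSpace ℝ (Fin 3)) 𝓘(ℝ, C2) (ambientMap κ τ H)
      (q : EuclideanSpace ℝ (Fin 3)) :=
    ((contDiffAt_ambientMap hκ hτ hH hz).differentiableAt (by simp)).mdifferentiableAt
  have h := mfderiv_comp_apply q hF (mdifferentiableAt_coe_S2 q) v
  rw [mfderiv_eq_fderiv] at h
  exact h.trans (fderiv_ambientMap hκ hτ hH hz _)

theorem injective_mfderiv_coe_S2 (q : S2) : Function.Injective
    (mfderiv (𝓡 2) 𝓘(ℝ, EuclideanSpace ℝ (Fin 3)) (Subtype.val : S2 → EuclideanSpace ℝ (Fin 3)) q) :=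
  have := finrank_E3
  injective_mvfderiv_subtypeVal_sphere q

theorem isImmersion_sphereMap (hκ : 0 < κ) (hτ : τ ≠ 0) (hH : 0 < H) :
    IsImmersion (sphereMap τ hκ hH) := by
  have hF : ContMDiff (𝓡 2) (𝓡 3) ∞ (sphereMap τ hκ hH) :=
    (contMDiff_ambientMap_coe hκ hτ hH).codRestrict_sphere _
  refine ⟨hF, fun q => ?_⟩
  rw [injective_iff_map_eq_zero]
  intro v hv
  have h := mfderiv_comp_apply q
    ((contMDiff_coe_sphere (E := C2) (n := 3) (m := 1)
      (sphereMap τ hκ hH q)).mdifferentiableAt one_ne_zero)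
    ((hF q).mdifferentiableAt (by simp)) v
  rw [hv, map_zero] at h
  have h2 := (mfderiv_ambientMap_coe hκ hτ hH q v).symm.trans h
  have h3 := eq_zero_of_ambientDeriv_eq_zero hκ hτ hH (sq_coord_le_one (S2_coord_sq q)) h2
  exact injective_mfderiv_coe_S2 q (h3.trans (map_zero _).symm)

theorem continuous_normalAt (hκ : 0 < κ) (hτ : τ ≠ 0) (hH : 0 < H) :
    Continuous fun q : S2 => normalAt κ τ H q := by
  have hz (q : S2) := sq_coord_le_one (S2_coord_sq q)
  have h2 : Continuous fun q : S2 => (q : EuclideanSpace ℝ (Fin 3)) 2 :=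
    (EuclideanSpace.proj (𝕜 := ℝ) (2 : Fin 3)).continuous.comp continuous_subtype_val
  have hs : Continuous fun q : S2 => scale κ τ H ((q : EuclideanSpace ℝ (Fin 3)) 2) :=
    continuous_iff_continuousAt.2 fun q =>
      (contDiffAt_scale hκ hH (hz q)).continuousAt.comp
        (f := fun q : S2 => (q : EuclideanSpace ℝ (Fin 3)) 2) h2.continuousAt
  have hfr : Continuous fun q : S2 => frame κ τ H ((q : EuclideanSpace ℝ (Fin 3)) 2) :=
    continuous_iff_continuousAt.2 fun q =>
      (hasDerivAt_frame hκ hτ hH (hz q)).continuousAt.comp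
        (f := fun q : S2 => (q : EuclideanSpace ℝ (Fin 3)) 2) h2.continuousAt
  have hF := (contMDiff_ambientMap_coe hκ hτ hH).continuous
  have hi : Continuous fun q : S2 => (2 * scale κ τ H ((q : EuclideanSpace ℝ (Fin 3)) 2))⁻¹ :=
    (continuous_const.mul hs).inv₀ fun q => (mul_pos two_pos (scale_pos hκ hH (hz q))).ne'
  exact ((hi.smul hfr).sub (hF.const_smul H)).sub
    (((continuous_const.mul h2).div_const _).smul (hF.const_smul Complex.I))

theorem isUnitNormal_normalAt (hκ : 0 < κ) (hτ : τ ≠ 0) (hH : 0 < H) :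
    IsUnitNormal κ τ (sphereMap τ hκ hH) fun q => normalAt κ τ H q where
  continuous := continuous_normalAt hκ hτ hH
  tangent q := (real_inner_comm _ _).trans (inner_normalAt_ambientMap hκ hH (S2_coord_sq q))
  unit q := metric_normalAt_self hκ hτ hH (S2_coord_sq q)
  normal q v := by
    have h := mfderiv_ambientMap_coe hκ hτ hH q v
    change metric κ τ (ambientMap κ τ H q)
      (mfderiv (𝓡 2) 𝓘(ℝ, C2) (fun q : S2 => ambientMap κ τ H q) q v) _ = 0
    rw [h]
    exact metric_ambientDeriv_normalAt hκ hτ hH (S2_coord_sq q) (mfderiv_coe_S2_tangent q v _ rfl)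

theorem hasConstantMeanCurvature_sphereMap (hκ : 0 < κ) (hτ : τ ≠ 0) (hH : 0 < H) :
    HasConstantMeanCurvature κ τ (sphereMap τ hκ hH) H := by
  refine ⟨_, isUnitNormal_normalAt hκ hτ hH, fun e he u hu => ?_⟩
  have hsymm : ContMDiffOn (𝓡 2) (𝓡 2) ∞ e.symm e.target :=
    contMDiffOn_symm_of_mem_maximalAtlas he
  have heM : e.MDifferentiable (𝓡 2) (𝓡 2) :=
    ⟨(contMDiffOn_of_mem_maximalAtlas he).mdifferentiableOn (by simp),
      hsymm.mdifferentiableOn (by simp)⟩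
  refine meanCurvature_ambientMap (ψ := fun v => (e.symm v : EuclideanSpace ℝ (Fin 3)))
    hκ hτ hH e.open_target ?_ (fun v => S2_coord_sq _) hu ?_
  · exact (contMDiff_coe_S2.comp_contMDiffOn hsymm).contDiffOn
  · have h := mfderiv_comp u (mdifferentiableAt_coe_S2 (e.symm u)) (heM.mdifferentiableAt_symm hu)
    rw [mfderiv_eq_fderiv] at h
    have h2 := (injective_mfderiv_coe_S2 (e.symm u)).comp (heM.symm.mfderiv_injective hu)
    intro x y hxy
    refine h2 ?_
    have hx := congrArg (fun L => L x) h
    have hy := congrArg (fun L => L y) h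
    exact hx.symm.trans (Eq.trans hxy hy)

end

/-! ### The polar angle -/

section

variable {κ τ H : ℝ}

theorem a_pos (hκ : 0 < κ) (hH : 0 < H) : 0 < a κ H :=
  Real.arctan_pos.2 (by positivity)

theorem a_lt_pi_div_two (κ H : ℝ) : a κ H < Real.pi / 2 := Real.arctan_lt_pi_div_two _

theorem cos_pos_of_mem {r : ℝ} (hr : r ∈ Set.Icc 0 (a κ H)) : 0 < Real.cos r :=
  Real.cos_pos_of_mem_Ioo
    ⟨by linarith [hr.1, Real.pi_pos], by linarith [hr.2, a_lt_pi_div_two κ H]⟩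

theorem tan_nonneg_of_mem {r : ℝ} (hr : r ∈ Set.Icc 0 (a κ H)) : 0 ≤ Real.tan r :=
  Real.tan_nonneg_of_nonneg_of_le_pi_div_two hr.1 (hr.2.trans (a_lt_pi_div_two κ H).le)

theorem tan_lt_tan_of_mem {r r' : ℝ} (hr : r ∈ Set.Icc 0 (a κ H)) (hr' : r' ∈ Set.Icc 0 (a κ H))
    (h : r < r') : Real.tan r < Real.tan r' :=
  Real.tan_lt_tan_of_nonneg_of_lt_pi_div_two hr.1 (hr'.2.trans_lt (a_lt_pi_div_two κ H)) h

/-- The endpoint `a` is where the numerator of `λ` vanishes; there the outer square root is not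
smooth, which is why the polar angle is only asked to be smooth off `x = 0`. -/
theorem sq_tan_a (hκ : 0 < κ) (hH : 0 < H) : 4 * H ^ 2 / κ * Real.tan (a κ H) ^ 2 = 1 := by
  rw [a, Real.tan_arctan, div_pow, Real.sq_sqrt hκ.le]
  field_simp
  norm_num

theorem lam_num_pos (hκ : 0 < κ) (hH : 0 < H) {r : ℝ} (h0 : 0 ≤ r) (h1 : r < a κ H) :
    0 < 1 - 4 * H ^ 2 / κ * Real.tan r ^ 2 := by
  have hr : r ∈ Set.Icc 0 (a κ H) := ⟨h0, h1.le⟩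
  have h := tan_lt_tan_of_mem hr ⟨(a_pos hκ hH).le, le_rfl⟩ h1
  have h2 : Real.tan r ^ 2 < Real.tan (a κ H) ^ 2 :=
    pow_lt_pow_left₀ h (tan_nonneg_of_mem hr) two_ne_zero
  have h3 : 4 * H ^ 2 / κ * Real.tan r ^ 2 < 4 * H ^ 2 / κ * Real.tan (a κ H) ^ 2 :=
    mul_lt_mul_of_pos_left h2 (by positivity)
  rw [sq_tan_a hκ hH] at h3
  linarith

theorem lam_den_pos (hκ : 0 < κ) (τ r : ℝ) : 0 < 1 + 4 * τ ^ 2 / κ * Real.tan r ^ 2 := by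
  positivity

theorem lam_zero : lam κ τ H 0 = 1 := by simp [lam]

theorem lam_a (hκ : 0 < κ) (hH : 0 < H) : lam κ τ H (a κ H) = 0 := by
  rw [lam, sq_tan_a hκ hH]; simp

theorem lam_nonneg (κ τ H r : ℝ) : 0 ≤ lam κ τ H r := by
  unfold lam; positivity

theorem strictAntiOn_lam (hκ : 0 < κ) (hH : 0 < H) :
    StrictAntiOn (lam κ τ H) (Set.Icc 0 (a κ H)) := by
  intro r hr r' hr' h
  have ht := pow_lt_pow_left₀ (tan_lt_tan_of_mem hr hr' h) (tan_nonneg_of_mem hr) two_ne_zero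
  have h1 : 4 * H ^ 2 / κ * Real.tan r ^ 2 < 4 * H ^ 2 / κ * Real.tan r' ^ 2 :=
    mul_lt_mul_of_pos_left ht (by positivity)
  have h2 : 4 * τ ^ 2 / κ * Real.tan r ^ 2 ≤ 4 * τ ^ 2 / κ * Real.tan r' ^ 2 :=
    mul_le_mul_of_nonneg_left ht.le (by positivity)
  have hn : √(1 - 4 * H ^ 2 / κ * Real.tan r' ^ 2) < √(1 - 4 * H ^ 2 / κ * Real.tan r ^ 2) :=
    (Real.sqrt_lt_sqrt_iff_of_pos (lam_num_pos hκ hH hr.1 (h.trans_le hr'.2))).2 (by linarith)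
  have hd : √(1 + 4 * τ ^ 2 / κ * Real.tan r ^ 2) ≤ √(1 + 4 * τ ^ 2 / κ * Real.tan r' ^ 2) :=
    Real.sqrt_le_sqrt (by linarith)
  have hp := Real.sqrt_pos.2 (lam_den_pos hκ τ r)
  unfold lam
  calc _ ≤ √(1 - 4 * H ^ 2 / κ * Real.tan r' ^ 2) / √(1 + 4 * τ ^ 2 / κ * Real.tan r ^ 2) :=
        div_le_div_of_nonneg_left (Real.sqrt_nonneg _) hp hd
    _ < _ := div_lt_div_of_pos_right hn hp

theorem lam_le_one (hκ : 0 < κ) (hH : 0 < H) {r : ℝ} (hr : r ∈ Set.Icc 0 (a κ H)) :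
    lam κ τ H r ≤ 1 := by
  rw [← lam_zero (κ := κ) (τ := τ) (H := H)]
  exact (strictAntiOn_lam hκ hH).antitoneOn ⟨le_rfl, (a_pos hκ hH).le⟩ hr hr.1

theorem sq_lam_le_one (hκ : 0 < κ) (hH : 0 < H) {r : ℝ} (hr : r ∈ Set.Icc 0 (a κ H)) :
    lam κ τ H r ^ 2 ≤ 1 :=
  pow_le_one₀ (lam_nonneg _ _ _ _) (lam_le_one hκ hH hr)

theorem continuousOn_lam (hκ : 0 < κ) : ContinuousOn (lam κ τ H) (Set.Icc 0 (a κ H)) := by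
  have ht : ContinuousOn Real.tan (Set.Icc 0 (a κ H)) := fun r hr =>
    (Real.continuousAt_tan.2 (cos_pos_of_mem hr).ne').continuousWithinAt
  exact (continuousOn_const.sub (continuousOn_const.mul (ht.pow 2))).sqrt.div
    (continuousOn_const.add (continuousOn_const.mul (ht.pow 2))).sqrt
    fun r _ => (Real.sqrt_pos.2 (lam_den_pos hκ τ r)).ne'

theorem contDiffAt_lam (hκ : 0 < κ) (hH : 0 < H) {r : ℝ} (hr : r ∈ Set.Ioo 0 (a κ H)) :
    ContDiffAt ℝ ∞ (lam κ τ H) r := by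
  have ht : ContDiffAt ℝ ∞ Real.tan r :=
    Real.contDiffAt_tan.2 (cos_pos_of_mem ⟨hr.1.le, hr.2.le⟩).ne'
  exact ((contDiffAt_const.sub (contDiffAt_const.mul (ht.pow 2))).sqrt
      (lam_num_pos hκ hH hr.1.le hr.2).ne').div
    ((contDiffAt_const.add (contDiffAt_const.mul (ht.pow 2))).sqrt (lam_den_pos hκ τ r).ne')
    (Real.sqrt_pos.2 (lam_den_pos hκ τ r)).ne'

theorem exists_hasDerivAt_lam (hκ : 0 < κ) (hH : 0 < H) {r : ℝ} (hr : r ∈ Set.Ioo 0 (a κ H)) :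
    ∃ d < 0, HasDerivAt (lam κ τ H) d r := by
  have hc := cos_pos_of_mem ⟨hr.1.le, hr.2.le⟩
  have ht : 0 < Real.tan r :=
    Real.tan_pos_of_pos_of_lt_pi_div_two hr.1 (hr.2.trans (a_lt_pi_div_two κ H))
  have hd := (Real.hasDerivAt_tan hc.ne').pow 2
  have hA := lam_num_pos hκ hH hr.1.le hr.2
  have hB := lam_den_pos hκ τ r
  have h1 := ((hd.const_mul (4 * H ^ 2 / κ)).const_sub 1).sqrt hA.ne'
  have h2 := ((hd.const_mul (4 * τ ^ 2 / κ)).const_add 1).sqrt hB.ne'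
  have hB' := Real.sqrt_pos.2 hB
  have hA' := Real.sqrt_pos.2 hA
  refine ⟨_, ?_, h1.div h2 hB'.ne'⟩
  refine div_neg_of_neg_of_pos ?_ (pow_pos hB' 2)
  have e1 : 0 < 4 * H ^ 2 / κ * (2 * Real.tan r ^ (2 - 1) * (1 / Real.cos r ^ 2)) := by positivity
  have e2 : 0 ≤ 4 * τ ^ 2 / κ * (2 * Real.tan r ^ (2 - 1) * (1 / Real.cos r ^ 2)) := by positivity
  refine sub_neg_of_lt (lt_of_lt_of_le (b := 0) ?_ ?_)
  · exact mul_neg_of_neg_of_pos (div_neg_of_neg_of_pos (neg_neg_of_pos e1) (by positivity)) hB'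
  · exact mul_nonneg hA'.le (div_nonneg e2 (by positivity))

/-! ### Cosine, sine and first coordinate in terms of `λ`. -/

theorem sq_lam_mul (hκ : 0 < κ) (hH : 0 < H) {r : ℝ} (hr : r ∈ Set.Icc 0 (a κ H)) :
    lam κ τ H r ^ 2 * (κ * Real.cos r ^ 2 + 4 * τ ^ 2 * Real.sin r ^ 2)
      = κ * Real.cos r ^ 2 - 4 * H ^ 2 * Real.sin r ^ 2 := by
  have hA : 0 ≤ 1 - 4 * H ^ 2 / κ * Real.tan r ^ 2 := by
    rcases hr.2.lt_or_eq with h | h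
    · exact (lam_num_pos hκ hH hr.1 h).le
    · rw [h, sq_tan_a hκ hH, sub_self]
  have hB := lam_den_pos hκ τ r
  have hc := cos_pos_of_mem hr
  rw [lam, div_pow, Real.sq_sqrt hA, Real.sq_sqrt hB.le, div_mul_eq_mul_div, div_eq_iff hB.ne',
    Real.tan_eq_sin_div_cos]
  field_simp

theorem cos_sq_mul_denom (hκ : 0 < κ) (hH : 0 < H) {r : ℝ} (hr : r ∈ Set.Icc 0 (a κ H)) :
    Real.cos r ^ 2 * denom κ τ H (lam κ τ H r) = 4 * (H ^ 2 + τ ^ 2 * lam κ τ H r ^ 2) := by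
  unfold denom
  linear_combination -sq_lam_mul (τ := τ) hκ hH hr
    + (4 * H ^ 2 + 4 * τ ^ 2 * lam κ τ H r ^ 2) * Real.cos_sq_add_sin_sq r

theorem cos_eq_of_mem (hκ : 0 < κ) (hH : 0 < H) {r : ℝ} (hr : r ∈ Set.Icc 0 (a κ H)) :
    Real.cos r = 2 * scale κ τ H (lam κ τ H r) * √(H ^ 2 + τ ^ 2 * lam κ τ H r ^ 2) := by
  have hz := sq_lam_le_one (τ := τ) hκ hH hr
  have hs := scale_pos (τ := τ) hκ hH hz
  refine (sq_eq_sq₀ (cos_pos_of_mem hr).le (by positivity)).1 ?_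
  rw [mul_pow, Real.sq_sqrt (by positivity)]
  linear_combination -(Real.cos r ^ 2) * scale_sq_mul_denom (τ := τ) hκ hH hz
    + scale κ τ H (lam κ τ H r) ^ 2 * cos_sq_mul_denom (τ := τ) hκ hH hr

theorem sin_eq_of_mem (hκ : 0 < κ) (hH : 0 < H) {r : ℝ} (hr : r ∈ Set.Icc 0 (a κ H)) :
    Real.sin r = √κ * scale κ τ H (lam κ τ H r) * √(1 - lam κ τ H r ^ 2) := by
  have hz := sq_lam_le_one (τ := τ) hκ hH hr
  have hs := scale_pos (τ := τ) hκ hH hz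
  have h0 : 0 ≤ Real.sin r := Real.sin_nonneg_of_nonneg_of_le_pi hr.1
    (by linarith [hr.2, a_lt_pi_div_two κ H, Real.pi_pos])
  refine (sq_eq_sq₀ h0 (by positivity)).1 ?_
  rw [mul_pow, mul_pow, Real.sq_sqrt (sub_nonneg.2 hz), Real.sq_sqrt hκ.le]
  have h1 := scale_sq_mul_denom (τ := τ) hκ hH hz
  have h2 := cos_sq_mul_denom (τ := τ) hκ hH hr
  unfold denom at h1 h2
  linear_combination -(Real.sin r ^ 2) * h1 - scale κ τ H (lam κ τ H r) ^ 2 * h2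
    + scale κ τ H (lam κ τ H r) ^ 2 * (4 * H ^ 2 + κ + (4 * τ ^ 2 - κ) * lam κ τ H r ^ 2)
      * Real.cos_sq_add_sin_sq r

/-- Polar form of `pole`: `-arctan (τ z / H)` is the argument of `H - iτz` because `H > 0`. -/
theorem pole_eq (hH : 0 < H) (z : ℝ) : pole κ τ H z
    = (2 * scale κ τ H z * √(H ^ 2 + τ ^ 2 * z ^ 2) : ℝ)
      * Complex.exp (Complex.I * angle κ τ H z) := by
  have hq : 0 < H ^ 2 + τ ^ 2 * z ^ 2 := by positivity
  have hq' := Real.sqrt_pos.2 hq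
  have hs : √(1 + (τ / H * z) ^ 2) = √(H ^ 2 + τ ^ 2 * z ^ 2) / H := by
    rw [show 1 + (τ / H * z) ^ 2 = (H ^ 2 + τ ^ 2 * z ^ 2) / H ^ 2 by field_simp,
      Real.sqrt_div hq.le, Real.sqrt_sq hH.le]
  have he : Complex.exp (Complex.I * ((-Real.arctan (τ / H * z) : ℝ) : ℂ))
      = (H - Complex.I * (τ * z)) / (√(H ^ 2 + τ ^ 2 * z ^ 2) : ℝ) := by
    rw [mul_comm, Complex.exp_mul_I, ← Complex.ofReal_cos, ← Complex.ofReal_sin, Real.cos_neg,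
      Real.sin_neg, Real.cos_arctan, Real.sin_arctan, hs]
    have hHc : (H : ℂ) ≠ 0 := by exact_mod_cast hH.ne'
    have hqc : ((√(H ^ 2 + τ ^ 2 * z ^ 2) : ℝ) : ℂ) ≠ 0 := by exact_mod_cast hq'.ne'
    push_cast
    field_simp
    ring
  have hqc : ((√(H ^ 2 + τ ^ 2 * z ^ 2) : ℝ) : ℂ) ≠ 0 := by exact_mod_cast hq'.ne'
  rw [angle, Complex.ofReal_add, mul_add, Complex.exp_add, he, pole]
  push_cast
  field_simp

theorem denom_neg (z : ℝ) : denom κ τ H (-z) = denom κ τ H z := by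
  unfold denom; ring

theorem scale_neg (z : ℝ) : scale κ τ H (-z) = scale κ τ H z := by
  rw [scale, denom_neg, scale]

/-- The height on `𝕊²` of the points with the parameter `x`. -/
def height (κ τ H x : ℝ) : ℝ :=
  lam κ τ H (a κ H + min x 0) - lam κ τ H (a κ H - max x 0)

/-- On each half one of the two summands of `height` is `λ(a) = 0`. -/
theorem height_of_nonpos (hκ : 0 < κ) (hH : 0 < H) {x : ℝ} (hx : x ≤ 0) :
    height κ τ H x = lam κ τ H (a κ H + x) := by
  rw [height, min_eq_left hx, max_eq_right hx, sub_zero, lam_a hκ hH, sub_zero]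

theorem height_of_nonneg (hκ : 0 < κ) (hH : 0 < H) {x : ℝ} (hx : 0 ≤ x) :
    height κ τ H x = -lam κ τ H (a κ H - x) := by
  rw [height, min_eq_right hx, max_eq_left hx, add_zero, lam_a hκ hH, zero_sub]

theorem height_neg (κ τ H x : ℝ) : height κ τ H (-x) = -height κ τ H x := by
  unfold height
  rw [show min (-x) 0 = -max x 0 by rw [← min_neg_neg, neg_zero],
    show max (-x) 0 = -min x 0 by rw [← max_neg_neg, neg_zero]]
  ring_nf

theorem add_mem_of_nonpos {x : ℝ} (hx : x ∈ Set.Icc (-a κ H) (a κ H)) (h : x ≤ 0) :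
    a κ H + x ∈ Set.Icc 0 (a κ H) := ⟨by linarith [hx.1], by linarith⟩

theorem sub_mem_of_nonneg {x : ℝ} (hx : x ∈ Set.Icc (-a κ H) (a κ H)) (h : 0 ≤ x) :
    a κ H - x ∈ Set.Icc 0 (a κ H) := ⟨by linarith [hx.2], by linarith⟩

theorem continuousOn_height (hκ : 0 < κ) (hH : 0 < H) :
    ContinuousOn (height κ τ H) (Set.Icc (-a κ H) (a κ H)) := by
  have ha := a_pos hκ hH
  refine ((continuousOn_lam hκ).comp (by fun_prop) ?_).sub
    ((continuousOn_lam hκ).comp (by fun_prop) ?_)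
  · intro x hx
    exact ⟨by linarith [le_min hx.1 (by linarith : -a κ H ≤ 0)], by linarith [min_le_right x 0]⟩
  · intro x hx
    exact ⟨by linarith [max_le hx.2 ha.le], by linarith [le_max_right x 0]⟩

theorem strictAntiOn_height (hκ : 0 < κ) (hH : 0 < H) :
    StrictAntiOn (height κ τ H) (Set.Icc (-a κ H) (a κ H)) := by
  have ha := a_pos hκ hH
  have h1 : StrictAntiOn (height κ τ H) (Set.Icc (-a κ H) 0) := by
    intro x hx x' hx' h
    rw [height_of_nonpos hκ hH hx.2, height_of_nonpos hκ hH hx'.2]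
    exact strictAntiOn_lam hκ hH (add_mem_of_nonpos ⟨hx.1, by linarith [hx.2]⟩ hx.2)
      (add_mem_of_nonpos ⟨hx'.1, by linarith [hx'.2]⟩ hx'.2) (by linarith)
  have h2 : StrictAntiOn (height κ τ H) (Set.Icc 0 (a κ H)) := by
    intro x hx x' hx' h
    rw [height_of_nonneg hκ hH hx.1, height_of_nonneg hκ hH hx'.1, neg_lt_neg_iff]
    exact strictAntiOn_lam hκ hH (sub_mem_of_nonneg ⟨by linarith [hx'.1], hx'.2⟩ hx'.1)
      (sub_mem_of_nonneg ⟨by linarith [hx.1], hx.2⟩ hx.1) (by linarith)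
  have := h1.union h2 (isGreatest_Icc (by linarith)) (isLeast_Icc ha.le)
  rwa [Set.Icc_union_Icc_eq_Icc (by linarith) ha.le] at this

theorem height_left (hκ : 0 < κ) (hH : 0 < H) : height κ τ H (-a κ H) = 1 := by
  rw [height_of_nonpos hκ hH (by linarith [a_pos hκ hH]), add_neg_cancel, lam_zero]

theorem height_right (hκ : 0 < κ) (hH : 0 < H) : height κ τ H (a κ H) = -1 := by
  rw [height_of_nonneg hκ hH (a_pos hκ hH).le, sub_self, lam_zero]

theorem height_mem (hκ : 0 < κ) (hH : 0 < H) {x : ℝ} (hx : x ∈ Set.Icc (-a κ H) (a κ H)) :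
    height κ τ H x ∈ Set.Icc (-1) 1 := by
  have ha := a_pos hκ hH
  have h := (strictAntiOn_height (τ := τ) hκ hH).antitoneOn
  rw [← height_right (τ := τ) hκ hH, ← height_left (τ := τ) hκ hH]
  exact ⟨h hx ⟨by linarith, le_rfl⟩ hx.2, h ⟨le_rfl, by linarith⟩ hx hx.1⟩

theorem sq_height_le_one (hκ : 0 < κ) (hH : 0 < H) {x : ℝ}
    (hx : x ∈ Set.Icc (-a κ H) (a κ H)) : height κ τ H x ^ 2 ≤ 1 := by
  obtain ⟨h1, h2⟩ := height_mem (τ := τ) hκ hH hx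
  nlinarith

theorem height_mem_Ioo (hκ : 0 < κ) (hH : 0 < H) {x : ℝ} (hx : x ∈ Set.Ioo (-a κ H) (a κ H)) :
    height κ τ H x ∈ Set.Ioo (-1) 1 := by
  have ha := a_pos hκ hH
  have h := strictAntiOn_height (τ := τ) hκ hH
  have hx' : x ∈ Set.Icc (-a κ H) (a κ H) := ⟨hx.1.le, hx.2.le⟩
  rw [← height_right (τ := τ) hκ hH, ← height_left (τ := τ) hκ hH]
  exact ⟨h hx' ⟨by linarith, le_rfl⟩ hx.2, h ⟨le_rfl, by linarith⟩ hx' hx.1⟩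

theorem abs_height (hκ : 0 < κ) (hH : 0 < H) (x : ℝ) :
    |height κ τ H x| = lam κ τ H (a κ H - |x|) := by
  rcases le_total x 0 with h | h
  · rw [height_of_nonpos hκ hH h, abs_of_nonpos h, abs_of_nonneg (lam_nonneg _ _ _ _),
      sub_neg_eq_add]
  · rw [height_of_nonneg hκ hH h, abs_of_nonneg h, abs_neg, abs_of_nonneg (lam_nonneg _ _ _ _)]

theorem sub_abs_mem {x : ℝ} (hx : x ∈ Set.Icc (-a κ H) (a κ H)) :
    a κ H - |x| ∈ Set.Icc 0 (a κ H) :=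
  ⟨by linarith [abs_le.2 hx], by linarith [abs_nonneg x]⟩

theorem scale_abs (z : ℝ) : scale κ τ H |z| = scale κ τ H z := by
  rcases abs_choice z with h | h <;> rw [h]
  exact scale_neg z

theorem pole_height (hκ : 0 < κ) (hH : 0 < H) {x : ℝ} (hx : x ∈ Set.Icc (-a κ H) (a κ H)) :
    pole κ τ H (height κ τ H x) = (Real.cos (a κ H - |x|) : ℝ)
      * Complex.exp (Complex.I * angle κ τ H (height κ τ H x)) := by
  rw [pole_eq hH, cos_eq_of_mem (τ := τ) hκ hH (sub_abs_mem hx), ← abs_height hκ hH, scale_abs,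
    sq_abs]

/-- The map `Φ` in terms of the height. -/
theorem Φ_eq (hκ : 0 < κ) (hτ : τ ≠ 0) (hH : 0 < H) {x : ℝ}
    (hx : x ∈ Set.Icc (-a κ H) (a κ H)) (t : ℝ) : Φ κ τ H x t
      = !₂[pole κ τ H (height κ τ H x),
        (Real.sin (a κ H - |x|) : ℂ) * Complex.exp (Complex.I * t)] := by
  rw [pole_height hκ hH hx, Φ]
  split_ifs with h
  · rw [abs_of_neg h, sub_neg_eq_add, height_of_nonpos hκ hH h.le, y_eq_angle, add_comm x]
  · rw [not_lt] at h
    -- Oddness of `angle` absorbs the sign change of the exponent in the second half of `Φ`.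
    rw [abs_of_nonneg h, height_of_nonneg hκ hH h, y_eq_angle,
      angle_neg hκ hτ hH (sq_lam_le_one hκ hH (sub_mem_of_nonneg hx h))]
    simp

theorem ambientMap_spherical (hκ : 0 < κ) (hτ : τ ≠ 0) (hH : 0 < H) {x : ℝ}
    (hx : x ∈ Set.Icc (-a κ H) (a κ H)) (t : ℝ) :
    ambientMap κ τ H (spherical (Real.arccos (height κ τ H x)) t) = Φ κ τ H x t := by
  obtain ⟨h1, h2⟩ := height_mem (τ := τ) hκ hH hx
  rw [Φ_eq hκ hτ hH hx, sin_eq_of_mem (τ := τ) hκ hH (sub_abs_mem hx), ← abs_height hκ hH,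
    scale_abs, sq_abs]
  simp only [ambientMap, spherical, PiLp.toLp_apply, Matrix.cons_val_zero, Matrix.cons_val_one,
    Matrix.cons_val, Real.cos_arccos h1 h2, Real.sin_arccos]
  rw [mul_comm Complex.I (t : ℂ), Complex.exp_mul_I]
  congr 3
  push_cast
  ring_nf

theorem isSphereOf_sphereMap (hκ : 0 < κ) (hτ : τ ≠ 0) (hH : 0 < H) :
    IsSphereOf κ τ H (fun x => Real.arccos (height κ τ H x)) (sphereMap τ hκ hH) := by
  have ha := a_pos hκ hH
  have hneg {x : ℝ} (hx : x ∈ Set.Ioo (-a κ H) (a κ H) \ {0}) (h : x < 0) :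
      a κ H + x ∈ Set.Ioo 0 (a κ H) ∧ height κ τ H =ᶠ[nhds x] fun v => lam κ τ H (a κ H + v) :=
    ⟨⟨by linarith [hx.1.1], by linarith⟩, by
      filter_upwards [Iio_mem_nhds h] with v hv using height_of_nonpos hκ hH (le_of_lt hv)⟩
  have hpos {x : ℝ} (hx : x ∈ Set.Ioo (-a κ H) (a κ H) \ {0}) (h : 0 < x) :
      a κ H - x ∈ Set.Ioo 0 (a κ H) ∧ height κ τ H =ᶠ[nhds x] fun v => -lam κ τ H (a κ H - v) :=
    ⟨⟨by linarith [hx.1.2], by linarith⟩, by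
      filter_upwards [Ioi_mem_nhds h] with v hv using height_of_nonneg hκ hH (le_of_lt hv)⟩
  refine ⟨?_, ?_, ?_, ?_, ?_, ?_, ?_⟩
  · exact Real.continuous_arccos.comp_continuousOn (continuousOn_height hκ hH)
  · intro x hx x' hx' h
    exact Real.strictAntiOn_arccos (height_mem hκ hH hx') (height_mem hκ hH hx)
      (strictAntiOn_height hκ hH hx hx' h)
  · simp only [height_left hκ hH, Real.arccos_one]
  · simp only [height_right hκ hH, Real.arccos_neg_one]
  · intro x hx
    have hm := height_mem_Ioo (τ := τ) hκ hH hx.1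
    have hd : ContDiffAt ℝ ∞ (height κ τ H) x := by
      rcases lt_or_gt_of_ne hx.2 with h | h
      · obtain ⟨h1, h2⟩ := hneg hx h
        exact ((contDiffAt_lam hκ hH h1).comp x
          (contDiffAt_const.add contDiffAt_id)).congr_of_eventuallyEq h2
      · obtain ⟨h1, h2⟩ := hpos hx h
        exact ((contDiffAt_lam hκ hH h1).comp x
          (contDiffAt_const.sub contDiffAt_id)).neg.congr_of_eventuallyEq h2
    exact ((Real.contDiffAt_arccos hm.1.ne' hm.2.ne).comp x hd).contDiffWithinAt
  · intro x hx
    have hm := height_mem_Ioo (τ := τ) hκ hH hx.1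
    obtain ⟨d, hd0, hd⟩ : ∃ d < 0, HasDerivAt (height κ τ H) d x := by
      rcases lt_or_gt_of_ne hx.2 with h | h
      · obtain ⟨h1, h2⟩ := hneg hx h
        obtain ⟨d, hd0, hd⟩ := exists_hasDerivAt_lam (τ := τ) hκ hH h1
        exact ⟨d, hd0, (hd.comp_const_add _ _).congr_of_eventuallyEq h2⟩
      · obtain ⟨h1, h2⟩ := hpos hx h
        obtain ⟨d, hd0, hd⟩ := exists_hasDerivAt_lam (τ := τ) hκ hH h1
        exact ⟨d, hd0, ((hd.comp_const_sub _ _).neg.congr_deriv (neg_neg d)).congr_of_eventuallyEq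
          h2⟩
    have h := (Real.hasDerivAt_arccos hm.1.ne' hm.2.ne).comp x hd
    rw [show deriv (fun x => Real.arccos (height κ τ H x)) x = _ from h.deriv]
    have hs : 0 < √(1 - height κ τ H x ^ 2) := Real.sqrt_pos.2 (by nlinarith [hm.1, hm.2])
    exact mul_pos_of_neg_of_neg (neg_neg_of_pos (by positivity)) hd0
  · intro x hx t _
    exact ambientMap_spherical hκ hτ hH ⟨hx.1.le, hx.2.le⟩ t

end

/-! ### Embeddedness -/

section

variable {κ τ H : ℝ}

theorem strictAntiOn_mul_angle (hκ : 0 < κ) (hτ : τ ≠ 0) (hH : 0 < H) :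
    StrictAntiOn (fun z => τ * angle κ τ H z) (Set.Icc 0 1) := by
  have hsq {z : ℝ} (hz : z ∈ Set.Icc (0 : ℝ) 1) : z ^ 2 ≤ 1 := pow_le_one₀ hz.1 hz.2
  refine strictAntiOn_of_deriv_neg (convex_Icc 0 1) ?_ ?_
  · intro z hz
    exact ((hasDerivAt_angle hκ hτ hH (hsq hz)).const_mul τ).continuousAt.continuousWithinAt
  · intro z hz
    have hz' := hsq (interior_subset hz)
    rw [((hasDerivAt_angle hκ hτ hH hz').const_mul τ).deriv]
    have hs := scale_pos (τ := τ) hκ hH hz'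
    rw [show τ * -(κ * H * (H ^ 2 + τ ^ 2) / τ * scale κ τ H z ^ 2 / (H ^ 2 + τ ^ 2 * z ^ 2))
      = -(κ * H * (H ^ 2 + τ ^ 2) * scale κ τ H z ^ 2 / (H ^ 2 + τ ^ 2 * z ^ 2)) by
        field_simp]
    exact neg_neg_of_pos (by positivity)

theorem mul_angle_neg (hκ : 0 < κ) (hτ : τ ≠ 0) (hH : 0 < H) {z : ℝ} (hz : z ∈ Set.Ioc 0 1) :
    τ * angle κ τ H z < 0 := by
  have := strictAntiOn_mul_angle hκ hτ hH ⟨le_rfl, zero_le_one⟩ ⟨hz.1.le, hz.2⟩ hz.1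
  simpa [angle_zero] using this

theorem abs_angle_abs (hκ : 0 < κ) (hτ : τ ≠ 0) (hH : 0 < H) {z : ℝ} (hz : z ^ 2 ≤ 1) :
    |(angle κ τ H |z|)| = |angle κ τ H z| := by
  rcases abs_choice z with h | h <;> rw [h]
  rw [angle_neg hκ hτ hH hz, abs_neg]

theorem abs_angle_le (hκ : 0 < κ) (hτ : τ ≠ 0) (hH : 0 < H) {z : ℝ} (hz : z ^ 2 ≤ 1) :
    |angle κ τ H z| ≤ |angle κ τ H 1| := by
  have hz1 : |z| ≤ 1 := (sq_le_one_iff_abs_le_one z).1 hz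
  have hanti := (strictAntiOn_mul_angle hκ hτ hH).antitoneOn
  have h0 := hanti ⟨le_rfl, zero_le_one⟩ ⟨abs_nonneg z, hz1⟩ (abs_nonneg z)
  have h1 := hanti ⟨abs_nonneg z, hz1⟩ ⟨zero_le_one, le_rfl⟩ hz1
  simp only [angle_zero, mul_zero] at h0 h1
  have h2 : |(τ * angle κ τ H |z|)| ≤ |τ * angle κ τ H 1| := by
    rw [abs_of_nonpos h0, abs_of_nonpos (h1.trans h0)]
    linarith
  rw [abs_mul, abs_mul, abs_angle_abs hκ hτ hH hz] at h2
  exact le_of_mul_le_mul_left h2 (abs_pos.2 hτ)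

theorem eq_zero_of_angle_eq_zero (hκ : 0 < κ) (hτ : τ ≠ 0) (hH : 0 < H) {z : ℝ} (hz : z ^ 2 ≤ 1)
    (h : angle κ τ H z = 0) : z = 0 := by
  by_contra hne
  have h1 := mul_angle_neg hκ hτ hH ⟨abs_pos.2 hne, (sq_le_one_iff_abs_le_one z).1 hz⟩
  have h2 := abs_angle_abs hκ hτ hH hz
  rw [h, abs_zero, abs_eq_zero] at h2
  rw [h2, mul_zero] at h1
  exact h1.false

/-! ### Spherical coordinates and extension to the closed rectangle. -/

theorem spherical_ne_of_lt {φ φ' t t' : ℝ} (h0 : φ ∈ Set.Icc 0 Real.pi)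
    (h1 : φ' ∈ Set.Icc 0 Real.pi) (h : φ < φ') : spherical φ t ≠ spherical φ' t' := by
  intro he
  have := congrArg (fun q : S2 => (q : EuclideanSpace ℝ (Fin 3)) 2) he
  simp only [spherical, PiLp.toLp_apply, Matrix.cons_val] at this
  exact h.ne (Real.injOn_cos h0 h1 this)

theorem exists_eq_spherical (q : S2) : ∃ φ ∈ Set.Icc 0 Real.pi,
    ∃ t ∈ Set.Icc (-Real.pi) Real.pi, q = spherical φ t := by
  set p : EuclideanSpace ℝ (Fin 3) := q.1 with hp
  have hq : p 0 ^ 2 + p 1 ^ 2 + p 2 ^ 2 = 1 := S2_coord_sq q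
  have h2 := abs_le.1 ((sq_le_one_iff_abs_le_one _).1 (sq_coord_le_one hq))
  set w : ℂ := ⟨p 0, p 1⟩ with hw
  have hn : Real.sin (Real.arccos (p 2)) = ‖w‖ := by
    rw [Real.sin_arccos, Complex.norm_def, Complex.normSq_mk]
    congr 1
    linarith
  refine ⟨Real.arccos (p 2), ⟨Real.arccos_nonneg _, Real.arccos_le_pi _⟩, Complex.arg w,
    ⟨(Complex.neg_pi_lt_arg w).le, Complex.arg_le_pi w⟩, Subtype.ext ?_⟩
  ext i
  fin_cases i
  · change p 0 = Real.sin (Real.arccos (p 2)) * Real.cos (Complex.arg w)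
    rw [hn, Complex.norm_mul_cos_arg]
  · change p 1 = Real.sin (Real.arccos (p 2)) * Real.sin (Complex.arg w)
    rw [hn, Complex.norm_mul_sin_arg]
  · exact (Real.cos_arccos h2.1 h2.2).symm

theorem continuous_spherical : Continuous fun q : ℝ × ℝ => spherical q.1 q.2 := by
  refine Continuous.subtype_mk ?_ _
  refine (PiLp.continuous_toLp 2 _).comp (continuous_pi fun i => ?_)
  fin_cases i <;> simp <;> fun_prop

theorem continuousOn_pole_comp_height (hκ : 0 < κ) (hτ : τ ≠ 0) (hH : 0 < H) :
    ContinuousOn (fun x => pole κ τ H (height κ τ H x)) (Set.Icc (-a κ H) (a κ H)) := fun x hx =>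
  (hasDerivAt_pole hκ hτ hH (sq_height_le_one hκ hH hx)).continuousAt.comp_continuousWithinAt
    (continuousOn_height hκ hH x hx)

theorem continuousOn_Φ (hκ : 0 < κ) (hτ : τ ≠ 0) (hH : 0 < H) :
    ContinuousOn (fun q : ℝ × ℝ => Φ κ τ H q.1 q.2)
      (Set.Icc (-a κ H) (a κ H) ×ˢ Set.Icc (-Real.pi) Real.pi) := by
  have h : ContinuousOn (fun q : ℝ × ℝ => (!₂[pole κ τ H (height κ τ H q.1),
        (Real.sin (a κ H - |q.1|) : ℂ) * Complex.exp (Complex.I * q.2)] : C2))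
      (Set.Icc (-a κ H) (a κ H) ×ˢ Set.Icc (-Real.pi) Real.pi) := by
    refine (PiLp.continuous_toLp 2 _).comp_continuousOn (continuousOn_pi.2 fun i => ?_)
    fin_cases i
    · exact (continuousOn_pole_comp_height hκ hτ hH).comp continuousOn_fst fun q hq => hq.1
    · simp
      fun_prop
  exact h.congr fun q hq => Φ_eq hκ hτ hH hq.1 q.2

section

variable {θ : ℝ → ℝ} {F : S2 → S3}

/-- The relation of `F` to `Φ` extends to the closed rectangle. -/
theorem IsSphereOf.eq_of_mem_Icc (hκ : 0 < κ) (hτ : τ ≠ 0) (hH : 0 < H)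
    (h : IsSphereOf κ τ H θ F) (hF : Continuous F) {x t : ℝ}
    (hx : x ∈ Set.Icc (-a κ H) (a κ H)) (ht : t ∈ Set.Icc (-Real.pi) Real.pi) :
    (F (spherical (θ x) t) : C2) = Φ κ τ H x t := by
  have ha := a_pos hκ hH
  have hpi := Real.pi_pos
  obtain ⟨G, hG⟩ : ∃ G : ℝ × ℝ → C2, ∀ φ t, G (φ, t) = (F (spherical φ t) : C2) :=
    ⟨fun q => F (spherical q.1 q.2), fun _ _ => rfl⟩
  have hGc : Continuous G := by
    have : G = fun q => (F (spherical q.1 q.2) : C2) := funext fun q => hG q.1 q.2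
    rw [this]
    exact continuous_subtype_val.comp (hF.comp continuous_spherical)
  have hc : ContinuousOn (fun q : ℝ × ℝ => (θ q.1, q.2))
      (Set.Icc (-a κ H) (a κ H) ×ˢ Set.Icc (-Real.pi) Real.pi) :=
    (h.continuousOn.comp continuousOn_fst fun q hq => hq.1).prodMk continuousOn_snd
  have hEq : Set.EqOn (fun q : ℝ × ℝ => G (θ q.1, q.2)) (fun q => Φ κ τ H q.1 q.2)
      (Set.Ioo (-a κ H) (a κ H) ×ˢ Set.Ioo (-Real.pi) Real.pi) := fun q hq =>
    (hG _ _).trans (h.eq q.1 hq.1 q.2 hq.2)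
  have := hEq.of_subset_closure (hGc.comp_continuousOn hc) (continuousOn_Φ hκ hτ hH)
    (Set.prod_mono Set.Ioo_subset_Icc_self Set.Ioo_subset_Icc_self) (by
      rw [closure_prod_eq, closure_Ioo (by linarith), closure_Ioo (by linarith)])
  rw [← hG]
  exact this (Set.mk_mem_prod hx ht)

theorem IsSphereOf.mem_Icc (hκ : 0 < κ) (hH : 0 < H) (h : IsSphereOf κ τ H θ F) {x : ℝ}
    (hx : x ∈ Set.Icc (-a κ H) (a κ H)) : θ x ∈ Set.Icc 0 Real.pi := by
  have ha := a_pos hκ hH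
  rw [← h.right, ← h.left]
  exact ⟨h.strictMonoOn.monotoneOn ⟨le_rfl, by linarith⟩ hx hx.1,
    h.strictMonoOn.monotoneOn hx ⟨by linarith, le_rfl⟩ hx.2⟩

theorem IsSphereOf.exists_eq (hκ : 0 < κ) (hH : 0 < H) (h : IsSphereOf κ τ H θ F) (q : S2) :
    ∃ x ∈ Set.Icc (-a κ H) (a κ H), ∃ t ∈ Set.Icc (-Real.pi) Real.pi,
      q = spherical (θ x) t := by
  obtain ⟨φ, hφ, t, ht, hq⟩ := exists_eq_spherical q
  have hs := intermediate_value_Icc (by linarith [a_pos hκ hH]) h.continuousOn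
  rw [h.left, h.right] at hs
  obtain ⟨x, hx, rfl⟩ := hs hφ
  exact ⟨x, hx, t, ht, hq⟩

theorem spherical_eq_of_sin_eq_zero {φ t t' : ℝ} (h : Real.sin φ = 0) :
    spherical φ t = spherical φ t' := by
  simp [spherical, h]

theorem cos_eq_and_sin_eq_of_exp_eq {t t' : ℝ}
    (h : Complex.exp (Complex.I * t) = Complex.exp (Complex.I * t')) :
    Real.cos t = Real.cos t' ∧ Real.sin t = Real.sin t' := by
  rw [mul_comm, mul_comm Complex.I] at h
  exact ⟨by simpa [Complex.exp_ofReal_mul_I_re] using congrArg Complex.re h,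
    by simpa [Complex.exp_ofReal_mul_I_im] using congrArg Complex.im h⟩

/-- The only possible double points lie on circles of opposite height, and these would need
`sin(angle) = 0` off the equator. -/
theorem IsSphereOf.injective (hκ : 0 < κ) (hτ : τ ≠ 0) (hH : 0 < H)
    (h : IsSphereOf κ τ H θ F) (hF : Continuous F) (hy : |angle κ τ H 1| < Real.pi) :
    Function.Injective F := by
  intro q q' hqq
  obtain ⟨x, hx, t, ht, rfl⟩ := h.exists_eq hκ hH q
  obtain ⟨x', hx', t', ht', rfl⟩ := h.exists_eq hκ hH q'
  have hΦ := congrArg (Subtype.val : S3 → C2) hqq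
  rw [h.eq_of_mem_Icc hκ hτ hH hF hx ht, h.eq_of_mem_Icc hκ hτ hH hF hx' ht',
    Φ_eq hκ hτ hH hx, Φ_eq hκ hτ hH hx'] at hΦ
  have e0 : pole κ τ H (height κ τ H x) = pole κ τ H (height κ τ H x') := by
    simpa using congrArg (fun p : C2 => p 0) hΦ
  have e1 : (Real.sin (a κ H - |x|) : ℂ) * Complex.exp (Complex.I * t)
      = (Real.sin (a κ H - |x'|) : ℂ) * Complex.exp (Complex.I * t') := by
    simpa using congrArg (fun p : C2 => p 1) hΦ
  have hm := sub_abs_mem hx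
  have hm' := sub_abs_mem hx'
  have hlt := a_lt_pi_div_two κ H
  have hsin0 {r : ℝ} (hr : r ∈ Set.Icc 0 (a κ H)) : 0 ≤ Real.sin r :=
    Real.sin_nonneg_of_nonneg_of_le_pi hr.1 (by linarith [hr.2, Real.pi_pos])
  have hn := congrArg norm e1
  rw [norm_mul, norm_mul, mul_comm Complex.I, mul_comm Complex.I, Complex.norm_exp_ofReal_mul_I,
    Complex.norm_exp_ofReal_mul_I, mul_one, mul_one, Complex.norm_real, Complex.norm_real,
    Real.norm_of_nonneg (hsin0 hm), Real.norm_of_nonneg (hsin0 hm')] at hn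
  have hr : a κ H - |x| = a κ H - |x'| := Real.injOn_sin
    ⟨by linarith [hm.1, Real.pi_pos], by linarith [hm.2]⟩
    ⟨by linarith [hm'.1, Real.pi_pos], by linarith [hm'.2]⟩ hn
  have hxx : x = x' := by
    rcases abs_eq_abs.1 (show |x| = |x'| by linarith) with hxx | hxx
    · exact hxx
    · have hc := cos_pos_of_mem hm
      rw [pole_height hκ hH hx, pole_height hκ hH hx', ← hr] at e0
      have e2 := mul_left_cancel₀ (Complex.ofReal_ne_zero.2 hc.ne') e0
      have hz := sq_height_le_one (τ := τ) hκ hH hx'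
      rw [hxx, height_neg, angle_neg hκ hτ hH hz] at e2
      have e3 := (cos_eq_and_sin_eq_of_exp_eq e2).2
      rw [Real.sin_neg] at e3
      have hA := abs_lt.1 ((abs_angle_le hκ hτ hH hz).trans_lt hy)
      have e4 := (Real.sin_eq_zero_iff_of_lt_of_lt hA.1 hA.2).1 (by linarith)
      have e5 := eq_zero_of_angle_eq_zero hκ hτ hH hz e4
      have ha := a_pos hκ hH
      have hh : height κ τ H x' = height κ τ H 0 := by
        rw [e5, height_of_nonneg hκ hH le_rfl, sub_zero, lam_a hκ hH, neg_zero]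
      have := (strictAntiOn_height hκ hH).injOn hx' ⟨by linarith, ha.le⟩ hh
      rw [hxx, this, neg_zero]
  subst hxx
  -- The sine vanishes only at the poles, where the longitude is irrelevant.
  by_cases hs : Real.sin (a κ H - |x|) = 0
  · have h0 : a κ H - |x| = 0 := Real.injOn_sin
      ⟨by linarith [hm.1, Real.pi_pos], by linarith [hm.2]⟩
      ⟨by linarith [Real.pi_pos], by linarith [Real.pi_pos]⟩ (by rw [hs, Real.sin_zero])
    refine spherical_eq_of_sin_eq_zero ?_
    rcases abs_eq (a_pos hκ hH).le |>.1 (show |x| = a κ H by linarith) with hxa | hxa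
    · rw [hxa, h.right, Real.sin_pi]
    · rw [hxa, h.left, Real.sin_zero]
  · obtain ⟨hcos, hsin⟩ := cos_eq_and_sin_eq_of_exp_eq (mul_left_cancel₀ (Complex.ofReal_ne_zero.2 hs) e1)
    simp [spherical, hcos, hsin]

theorem IsSphereOf.not_injective (hκ : 0 < κ) (hτ : τ ≠ 0) (hH : 0 < H)
    (h : IsSphereOf κ τ H θ F) (hF : Continuous F) (hy : Real.pi ≤ |angle κ τ H 1|) :
    ¬ Function.Injective F := by
  intro hinj
  have ha := a_pos hκ hH
  -- At a height where the angle is `±π`, the points of heights `±z` have the same first coordinate,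
  -- as `exp(iπ) = exp(-iπ)`.
  have hpi := Real.pi_pos
  have hcont : ContinuousOn (fun r => |angle κ τ H (lam κ τ H r)|) (Set.Icc 0 (a κ H)) :=
    fun r hr => (((hasDerivAt_angle hκ hτ hH
      (sq_lam_le_one hκ hH hr)).continuousAt.comp_continuousWithinAt
        (continuousOn_lam hκ r hr))).abs
  obtain ⟨r, hr, hrpi⟩ := intermediate_value_Icc' ha.le hcont
    (show Real.pi ∈ _ by
      simp only [lam_zero, lam_a hκ hH, angle_zero, abs_zero]
      exact ⟨hpi.le, hy⟩)
  simp only at hrpi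
  have hra : r < a κ H := by
    refine lt_of_le_of_ne hr.2 fun he => ?_
    rw [he, lam_a hκ hH, angle_zero, abs_zero] at hrpi
    exact hpi.ne hrpi
  have hx : a κ H - r ∈ Set.Icc (-a κ H) (a κ H) := ⟨by linarith, by linarith [hr.1]⟩
  have hx' : -(a κ H - r) ∈ Set.Icc (-a κ H) (a κ H) := ⟨by linarith [hr.1], by linarith⟩
  have h0 : (0 : ℝ) ∈ Set.Icc (-Real.pi) Real.pi := ⟨by linarith, hpi.le⟩
  have hz := sq_height_le_one (τ := τ) hκ hH hx
  have hexp : Complex.exp (Complex.I * angle κ τ H (-height κ τ H (a κ H - r)))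
      = Complex.exp (Complex.I * angle κ τ H (height κ τ H (a κ H - r))) := by
    have habs : |angle κ τ H (height κ τ H (a κ H - r))| = Real.pi := by
      rw [← abs_angle_abs hκ hτ hH hz, abs_height hκ hH, abs_of_pos (sub_pos.2 hra),
        sub_sub_cancel, hrpi]
    have e1 : Complex.exp (Complex.I * (Real.pi : ℝ)) = -1 := by
      rw [mul_comm, Complex.exp_pi_mul_I]
    have e2 : Complex.exp (Complex.I * ((-Real.pi : ℝ) : ℂ)) = -1 := by
      rw [Complex.ofReal_neg, mul_neg, Complex.exp_neg, e1]
      norm_num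
    rw [angle_neg hκ hτ hH hz]
    rcases (abs_eq hpi.le).1 habs with he | he <;> rw [he]
    · rw [e2, e1]
    · rw [neg_neg, e2, e1]
  have heq : F (spherical (θ (-(a κ H - r))) 0) = F (spherical (θ (a κ H - r)) 0) := by
    refine Subtype.ext ?_
    rw [h.eq_of_mem_Icc hκ hτ hH hF hx' h0, h.eq_of_mem_Icc hκ hτ hH hF hx h0,
      Φ_eq hκ hτ hH hx', Φ_eq hκ hτ hH hx, pole_height hκ hH hx', pole_height hκ hH hx,
      height_neg, hexp, abs_neg]
  exact spherical_ne_of_lt (h.mem_Icc hκ hH hx') (h.mem_Icc hκ hH hx)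
    (h.strictMonoOn hx' hx (by linarith)) (hinj heq)

theorem IsSphereOf.isEmbedding_iff (hκ : 0 < κ) (hτ : τ ≠ 0) (hH : 0 < H)
    (h : IsSphereOf κ τ H θ F) (hF : IsImmersion F) :
    IsEmbedding F ↔ |y κ τ H 0| < Real.pi := by
  rw [y_eq_angle, lam_zero]
  have hc := hF.1.continuous
  refine ⟨fun hE => ?_, fun hy => ?_⟩
  · by_contra hy
    exact h.not_injective hκ hτ hH hc (not_lt.1 hy) hE.2.injective
  -- A continuous injection of the compact `𝕊²` into a Hausdorff space is a closed embedding.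
  · exact ⟨hF, (hc.isClosedEmbedding (h.injective hκ hτ hH hc hy)).isEmbedding⟩

end

end

end BergerSphere

end

theorem mainTheorem3 (κ τ H : ℝ) (hκ : 0 < κ) (hτ : τ ≠ 0) (hκτ : κ - 4 * τ ^ 2 ≠ 0)
    (hH : 0 < H) :
    (∃ (θ : ℝ → ℝ) (F : BergerSphere.S2 → BergerSphere.S3),
      BergerSphere.IsSphereOf κ τ H θ F ∧
      BergerSphere.IsImmersion F ∧
      BergerSphere.HasConstantMeanCurvature κ τ F H) ∧
    (∀ (θ : ℝ → ℝ) (F : BergerSphere.S2 → BergerSphere.S3),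
      BergerSphere.IsSphereOf κ τ H θ F → BergerSphere.IsImmersion F →
      (0 < τ → (BergerSphere.IsEmbedding F ↔ -Real.pi < BergerSphere.y κ τ H 0)) ∧
      (τ < 0 → (BergerSphere.IsEmbedding F ↔ BergerSphere.y κ τ H 0 < Real.pi))) := by
  refine ⟨⟨_, _, BergerSphere.isSphereOf_sphereMap hκ hτ hH,
    BergerSphere.isImmersion_sphereMap hκ hτ hH,
    BergerSphere.hasConstantMeanCurvature_sphereMap hκ hτ hH⟩, fun θ F h hF => ?_⟩
  -- The sign of `y(0)` is opposite to that of `τ`, so one side of `|y(0)| < π` is automatic.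
  have hneg : τ * BergerSphere.y κ τ H 0 < 0 := by
    rw [BergerSphere.y_eq_angle, BergerSphere.lam_zero]
    exact BergerSphere.mul_angle_neg hκ hτ hH ⟨zero_lt_one, le_rfl⟩
  rw [h.isEmbedding_iff hκ hτ hH hF, abs_lt]
  refine ⟨fun hpos => ⟨fun hy => hy.1, fun hy => ⟨hy, ?_⟩⟩,
    fun hτneg => ⟨fun hy => hy.2, fun hy => ⟨?_, hy⟩⟩⟩
  · exact (neg_of_mul_neg_right hneg hpos.le).trans Real.pi_pos
  · have : 0 < BergerSphere.y κ τ H 0 := pos_of_mul_neg_right hneg hτneg.le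
    linarith [Real.pi_pos]
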